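/- All rings are commutative, noetherian and have an identity; all monoids are commutative, cancellative and torsion-free ($x^c=y^c$ with $c\ge 1$ implies $x=y$). Fix one of two cases, symplectic or orthogonal. Notation for rings. Let $A$ be a commutative ring and $n\ge 1$. Let $\sigma=(1\,2)(3\,4)\cdots(2n-1\;2n)$, let $e_{ij}$ be the matrix units, and equip $A^{2n}$ with $\langle u,v\rangle=u^T\Phi_n v$, where $\Phi_n$ is the orthogonal sum of $n$ copies of $\begin{pmatrix}0&1\\-1&0\end{pmatrix}$ (symplectic case) or of $\begin{pmatrix}0&1\\1&0\end{pmatrix}$ (orthogonal case). $\mathrm{Um}(2n,A)$ is the set of rows $v\in A^{2n}$ such that $\sum_i v_iw_i=1$ for some $w\in A^{2n}$ and, in the orthogonal case, also $\langle v,v\rangle=0$. $\mathrm{E}(2n,A)$ is the subgroup of $\mathrm{GL}_{2n}(A)$ generated, for $1\le i<j\le 2n$ with $j\ne\sigma(i)$ and $\lambda\in A$, * in the symplectic case by all $\mathrm{Id}+\lambda e_{ij}-\lambda(-1)^{i+j}e_{\sigma(j)\sigma(i)}$, together with all $\mathrm{Id}+\lambda e_{k\,\sigma(k)}$ for $1\le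 k\le 2n$; * in the orthogonal case by all $\mathrm{Id}+\lambda e_{ij}-\lambda e_{\sigma(j)\sigma(i)}$. It acts on $\mathrm{Um}(2n,A)$ by right multiplication; write $\mathrm{Um}(2n,A)/\mathrm{E}(2n,A)=\{*\}$ if this action is transitive. If $R$ has Krull dimension $d$, put $\mathbb D(R)=\max\{4,d+2\}$ in the symplectic case and $\mathbb D(R)=\max\{6,2d+4\}$ in the orthogonal case. Notation for monoids. Let $\mathrm{gp}(M)$ be the group completion of a monoid $M$. $M$ is affine if it is finitely generated and isomorphic to a submonoid of some $\mathbb Z^d$; positive if its only unit is $1$; normal if every $x\in\mathrm{gp}(M)$ with $x^c\in M$ for some $c\ge1$ lies in $M$; seminormal if every $x\in\mathrm{gp}(M)$ with $x^2,x^3\in M$ lies in $M$. For an affine monoid $N$, let $\mathbb R_+N$ be the cone generated by $N$ in $\mathrm{gp}(N)\otimes\mathbb R$, let $\mathrm{int}(N)$ be the set of elements of $N$ lying in the interior of $\mathbb R_+N$ in $\mathrm{gp}(N)\otimes\mathbb R$, and put $N_*=\mathrm{int}(N)\cup\{1\}$, a submonoid of $N$. **Proposition.** Let $R$ be a ring,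 with $\mathrm{char}(R)\neq2$ in the orthogonal case, and let $2n\ge\mathbb D(R)$. Assume that $\mathrm{Um}(2n,R[N_*])/\mathrm{E}(2n,R[N_*])=\{*\}$ for every affine positive normal monoid $N$. Then $\mathrm{Um}(2n,R[M])/\mathrm{E}(2n,R[M])=\{*\}$ for every seminormal monoid $M$. -/

import Mathlib

open scoped TensorProduct Matrix

noncomputable section

namespace MonoidRows

/-! ### Commutative monoids, written additively

The monoid operation is written additively throughout, so that the neutral element is `0`, a power
`x ^ c` is `c • x`, and the monoid ring `R[M]` is `AddMonoidAlgebra R M`. -/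

section Monoids

variable (M : Type*) [AddCommMonoid M]

/-- The canonical map from `M` to its group completion `gp(M)`. -/
abbrev toGp : M →+ Algebra.GrothendieckAddGroup M := Algebra.GrothendieckAddGroup.of

/-- `M` is affine: finitely generated and isomorphic to a submonoid of some `ℤ ^ d`. -/
def IsAffine : Prop :=
  AddMonoid.FG M ∧ ∃ (d : ℕ) (f : M →+ (Fin d → ℤ)), Function.Injective f

/-- `M` is positive: its group of units is trivial. -/
def IsPositive : Prop :=
  ∀ x : M, IsAddUnit x → x = 0

/-- `M` is normal: every element of `gp(M)` with a positive multiple in `M` lies in `M`. -/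
def IsNormal : Prop :=
  ∀ x : Algebra.GrothendieckAddGroup M, ∀ c : ℕ, 0 < c →
    c • x ∈ Set.range (toGp M) → x ∈ Set.range (toGp M)

/-- `M` is seminormal: every `x` in `gp(M)` with `2 x` and `3 x` in `M` lies in `M`. -/
def IsSeminormal : Prop :=
  ∀ x : Algebra.GrothendieckAddGroup M,
    2 • x ∈ Set.range (toGp M) → 3 • x ∈ Set.range (toGp M) → x ∈ Set.range (toGp M)

/-- The real vector space `gp(M) ⊗ ℝ`. -/
abbrev RealSpan : Type _ := ℝ ⊗[ℤ] Algebra.GrothendieckAddGroup M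

variable {M} in
/-- The canonical map `M → gp(M) ⊗ ℝ`. -/
def toReal (m : M) : RealSpan M := (1 : ℝ) ⊗ₜ[ℤ] toGp M m

/-- The cone `ℝ₊ M` of all combinations of elements of `M` with non-negative real coefficients. -/
def cone : PointedCone ℝ (RealSpan M) := PointedCone.hull ℝ (Set.range (toReal (M := M)))

/-- The interior of the cone `ℝ₊ M` in `gp(M) ⊗ ℝ`. The topology is the module topology, which is
the usual topology whenever the vector space is finite-dimensional. -/
def coneInterior : Set (RealSpan M) :=
  @interior (RealSpan M) (moduleTopology ℝ (RealSpan M)) (cone M : Set (RealSpan M))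

variable {M} in
theorem toReal_add (x y : M) : toReal (x + y) = toReal x + toReal y := by
  simp [toReal, TensorProduct.tmul_add]

variable {M} in
theorem toReal_mem_cone (x : M) : toReal x ∈ cone M :=
  Submodule.subset_span (Set.mem_range_self x)

variable {M} in
theorem coneInterior_add {v w : RealSpan M} (hv : v ∈ coneInterior M) (hw : w ∈ cone M) :
    v + w ∈ coneInterior M := by
  let _ : TopologicalSpace (RealSpan M) := moduleTopology ℝ (RealSpan M)
  have _ : ContinuousAdd (RealSpan M) := ModuleTopology.continuousAdd ℝ (RealSpan M)
  change v + w ∈ interior (cone M : Set (RealSpan M))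
  change v ∈ interior (cone M : Set (RealSpan M)) at hv
  rw [mem_interior] at hv ⊢
  obtain ⟨U, hU, hUo, hvU⟩ := hv
  refine ⟨(fun z => z + -w) ⁻¹' U, fun z hz => ?_, hUo.preimage (by fun_prop), ?_⟩
  · have h := (cone M).add_mem (hU hz) hw
    simpa using h
  · simpa using hvU

/-- The submonoid `M_* = int(M) ∪ {0}`, where `int(M) = M ∩ int(ℝ₊ M)`. -/
def interiorMonoid : AddSubmonoid M where
  carrier := {m | toReal m ∈ coneInterior M} ∪ {0}
  zero_mem' := Or.inr rfl
  add_mem' := by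
    rintro a b (ha | rfl) (hb | rfl)
    · left
      change toReal (a + b) ∈ coneInterior M
      rw [toReal_add]
      exact coneInterior_add ha (toReal_mem_cone b)
    · left
      simpa using ha
    · left
      simpa using hb
    · right
      simp

end Monoids

/-! ### Unimodular rows and elementary classical groups -/

/-- The two types of classical groups: symplectic and orthogonal. -/
inductive ClassicalType : Type
  | symplectic
  | orthogonal

/-- The positions `1, …, 2n` of a row of length `2n`: the pair `(k, ε)` stands for the position
`2k + 1 + ε`, so `(k, 0)` and `(k, 1)` form the `k`-th hyperbolic pair. -/
abbrev Pos (n : ℕ) : Type := Fin n × Fin 2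

/-- The permutation `σ = (1 2)(3 4) ⋯ (2n-1 2n)` of the positions. -/
def swap {n : ℕ} (i : Pos n) : Pos n := (i.1, Fin.rev i.2)

section Rows

variable (T : ClassicalType) (n : ℕ) (A : Type*) [CommRing A]

/-- The standard form of rank `2n`: the orthogonal sum of `n` blocks `(0 1; -1 0)` in the
symplectic case and of `n` blocks `(0 1; 1 0)` in the orthogonal case. -/
def formMatrix : Matrix (Pos n) (Pos n) A :=
  Matrix.of fun i j =>
    if j = swap i then
      match T with
      | .symplectic => (-1) ^ (i.2 : ℕ)
      | .orthogonal => 1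
    else 0

/-- The set `Um(2n, A)` of unimodular rows. In the orthogonal case the rows are moreover required
to be isotropic. -/
def Um : Set (Pos n → A) :=
  {v | (∃ w : Pos n → A, v ⬝ᵥ w = 1) ∧
    (T = .orthogonal → v ⬝ᵥ (formMatrix T n A *ᵥ v) = 0)}

variable {n A} in
/-- The matrices `se_ij(a) = 1 + a e_ij - a (-1)^(i+j) e_σ(j)σ(i)` (symplectic case) and
`oe_ij(a) = 1 + a e_ij - a e_σ(j)σ(i)` (orthogonal case). The exponent `i + j` matters only modulo
two, and the parity of the position `(k, ε)` is that of `ε + 1`. -/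
def shortGen (i j : Pos n) (a : A) : Matrix (Pos n) (Pos n) A :=
  match T with
  | .symplectic => 1 + Matrix.single i j a
      - Matrix.single (swap j) (swap i) (a * (-1) ^ ((i.2 : ℕ) + (j.2 : ℕ)))
  | .orthogonal => 1 + Matrix.single i j a - Matrix.single (swap j) (swap i) a

/-- The set of elementary generators: the matrices `se_ij(a)`, respectively `oe_ij(a)`, for
positions `i < j` with `σ(i) ≠ j` (that is, `i` lies in an earlier pair than `j`) and, in the
symplectic case only, the matrices `1 + a e_iσ(i)` for all positions `i`. -/
def elementaryGenerators : Set (Matrix (Pos n) (Pos n) A) :=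
  {g | (∃ (i j : Pos n) (a : A), i.1 < j.1 ∧ g = shortGen T i j a) ∨
    (T = .symplectic ∧ ∃ (i : Pos n) (a : A), g = 1 + Matrix.single i (swap i) a)}

/-- The elementary group `E(2n, A)`, which is `ESp` in the symplectic and `EO` in the orthogonal
case: the group of invertible matrices generated by the elementary generators. -/
def E : Subgroup (GL (Pos n) A) :=
  Subgroup.closure {g | (g : Matrix (Pos n) (Pos n) A) ∈ elementaryGenerators T n A}

/-- `Um(2n, A) / E(2n, A) = {*}`: any two unimodular rows are in the same orbit of `E(2n, A)`, which
acts by multiplication on the right. (For `n > 0` there is always a unimodular row, namely `e₁`.) -/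
def TrivialOrbitSpace : Prop :=
  ∀ u ∈ Um T n A, ∀ v ∈ Um T n A, ∃ g ∈ E T n A, u ᵥ* (g : Matrix (Pos n) (Pos n) A) = v

end Rows

/-- With `d` the Krull dimension of `R`, the number `max {4, d + 2}` in the symplectic case and
`max {6, 2 d + 4}` in the orthogonal case (it is infinite if `d` is). -/
def stableBound (T : ClassicalType) (R : Type*) [CommRing R] : WithBot ℕ∞ :=
  match T with
  | .symplectic => max 4 (ringKrullDim R + 2)
  | .orthogonal => max 6 (2 * ringKrullDim R + 4)

end MonoidRows

end

noncomputable section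

namespace MonoidRows

/-! ### Orbits of the elementary group -/

section Orbits

variable {T : ClassicalType} {n : ℕ} {A : Type*} [CommRing A]

/-! The idea is to bring rows into submonoids `H` of a lattice that are positive, saturated and
consist, apart from `0`, of interior elements (`IsOpenSubmonoid`). Such an `H` is a directed union
of monoids `N_*` with `N` affine, positive and normal: given finitely many elements of `H`, enlarge
them so that each nonzero one becomes interior, then saturate. Since a row and a witness of its
unimodularity involve only finitely many monoid elements, the hypothesis yields triviality over
`R[H]` (`trivialOrbitSpace_of_isOpenSubmonoid`).

Group rings `R[ℤ^r]` are reduced to this case by a Laurent analogue of Suslin's monic polynomial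
argument (`trivialOrbitSpace_int`). Elements with a lowest term of coefficient one contain a
multiplicative set `S` such that all primes disjoint from `S` have height at most `d`, where `d`
bounds the dimension of `R` (`hasLowestSystem_int`). Stability arguments carried out only at those
primes give one coordinate a lowest term (`exists_rel_add_mul_symplectic`,
`exists_rel_add_mul_orthogonal`). Elementary operations then make the row congruent to a unit vector
modulo terms of positive degree for a linear form `φ` (`exists_rel_sub_single_mem_filt`). The row
now lives over the open monoid `{φ > 0} ∪ {0}`.

For a seminormal monoid, finitely many elements lie in a seminormal submonoid `K` of some `ℤ^r` with
finitely many faces. The row is normalized face by face (`exists_rel_forall_faceRestrict`). The face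
of units is a lattice and is covered by the group ring case. For any other face `F`, once the
smaller faces are done, the restriction to `F` differs from the unit vector only by interior terms;
seminormality makes the interior of `F` with `0` an open monoid, and the reduction over it does not
disturb the faces already treated. The last face is `K` itself. -/

@[simp] lemma swap_fst (i : Pos n) : (swap i).1 = i.1 := rfl

@[simp] lemma swap_swap (i : Pos n) : swap (swap i) = i := by
  simp [swap]

lemma swap_ne (i : Pos n) : swap i ≠ i := by
  intro h
  have := congrArg Prod.snd h
  obtain ⟨k, e⟩ := i
  fin_cases e <;> simp [swap, Fin.rev] at this

lemma swap_mk_zero (k : Fin n) : swap ((k, 0) : Pos n) = (k, 1) := rfl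

lemma swap_mk_one (k : Fin n) : swap ((k, 1) : Pos n) = (k, 0) := rfl

lemma swap_injective : Function.Injective (swap : Pos n → Pos n) :=
  fun a b h => by rw [← swap_swap a, h, swap_swap]

lemma eq_or_eq_swap {i j : Pos n} (h : i.1 = j.1) : i = j ∨ i = swap j := by
  obtain ⟨k, e⟩ := i
  obtain ⟨l, f⟩ := j
  obtain rfl : k = l := h
  fin_cases e <;> fin_cases f <;> simp [swap, Fin.rev]

/-- Two rows are elementarily equivalent if they lie in the same orbit of `E(2n, A)`. -/
def Rel (T : ClassicalType) (u v : Pos n → A) : Prop :=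
  ∃ g ∈ E T n A, u ᵥ* (g : Matrix (Pos n) (Pos n) A) = v

lemma Rel.refl (u : Pos n → A) : Rel T u u := ⟨1, one_mem _, by simp⟩

lemma Rel.trans {u v w : Pos n → A} (h : Rel T u v) (h' : Rel T v w) : Rel T u w := by
  obtain ⟨g, hg, rfl⟩ := h
  obtain ⟨g', hg', rfl⟩ := h'
  exact ⟨g * g', mul_mem hg hg', by simp [Matrix.vecMul_vecMul]⟩

lemma Rel.symm {u v : Pos n → A} (h : Rel T u v) : Rel T v u := by
  obtain ⟨g, hg, rfl⟩ := h
  refine ⟨g⁻¹, inv_mem hg, ?_⟩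
  rw [Matrix.vecMul_vecMul, ← Units.val_mul, mul_inv_cancel]
  simp

/-- The sign occurring in `shortGen`. -/
def sgn (T : ClassicalType) (A : Type*) [CommRing A] (i j : Pos n) : A :=
  match T with
  | .symplectic => (-1) ^ ((i.2 : ℕ) + (j.2 : ℕ))
  | .orthogonal => 1

lemma sgn_mul_self (i j : Pos n) : sgn T A i j * sgn T A i j = 1 := by
  cases T <;> simp [sgn, ← pow_add, ← two_mul]

lemma sgn_swap_swap (i j : Pos n) : sgn T A (swap j) (swap i) = sgn T A i j := by
  cases T
  · obtain ⟨k, e⟩ := i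
    obtain ⟨l, f⟩ := j
    fin_cases e <;> fin_cases f <;> simp [sgn, swap, Fin.rev]
  · rfl

lemma shortGen_eq (i j : Pos n) (a : A) :
    shortGen T i j a = 1 + Matrix.single i j a
      - Matrix.single (swap j) (swap i) (a * sgn T A i j) := by
  cases T <;> simp [shortGen, sgn]

lemma vecMul_single' (v : Pos n → A) (i j : Pos n) (a : A) :
    v ᵥ* Matrix.single i j a = Pi.single j (v i * a) := by
  ext k
  by_cases h : k = j
  · subst h
    simp [Matrix.vecMul, dotProduct, Matrix.single_apply]
  · simp [Matrix.vecMul, dotProduct, h, Ne.symm h]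

lemma shortGen_mul_neg {i j : Pos n} (h : i.1 ≠ j.1) (a : A) :
    shortGen T i j a * shortGen T i j (-a) = 1 := by
  have h1 : i ≠ j := fun e => h (by rw [e])
  have h2 : swap i ≠ swap j := fun e => h1 (swap_injective e)
  have h3 : j ≠ swap j := (swap_ne j).symm
  have h4 : swap i ≠ i := swap_ne i
  simp only [shortGen_eq, mul_sub, mul_add, sub_mul, add_mul, mul_one, one_mul,
    Matrix.single_mul_single_of_ne _ _ _ _ h1.symm, Matrix.single_mul_single_of_ne _ _ _ _ h2,
    Matrix.single_mul_single_of_ne _ _ _ _ h3, Matrix.single_mul_single_of_ne _ _ _ _ h4]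
  simp only [neg_mul, ← Matrix.single_neg]
  abel

/-- The generator `shortGen` as an invertible matrix. -/
def shortUnit (T : ClassicalType) {i j : Pos n} (h : i.1 ≠ j.1) (a : A) : GL (Pos n) A where
  val := shortGen T i j a
  inv := shortGen T i j (-a)
  val_inv := shortGen_mul_neg h a
  inv_val := by simpa using shortGen_mul_neg (T := T) h (-a)

/-- The generator `1 + a e_iσ(i)` as an invertible matrix. -/
def longUnit (i : Pos n) (a : A) : GL (Pos n) A where
  val := 1 + Matrix.single i (swap i) a
  inv := 1 + Matrix.single i (swap i) (-a)
  val_inv := by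
    simp only [mul_add, add_mul, mul_one, one_mul,
      Matrix.single_mul_single_of_ne _ _ _ _ (swap_ne i)]
    simp [add_assoc, ← Matrix.single_add]
  inv_val := by
    simp only [mul_add, add_mul, mul_one, one_mul,
      Matrix.single_mul_single_of_ne _ _ _ _ (swap_ne i)]
    simp [add_assoc, ← Matrix.single_add]

lemma vecMul_shortGen (v : Pos n → A) (i j : Pos n) (a : A) :
    v ᵥ* shortGen T i j a = v + Pi.single j (a * v i)
      - Pi.single (swap i) (sgn T A i j * a * v (swap j)) := by
  rw [shortGen_eq, Matrix.vecMul_sub, Matrix.vecMul_add, Matrix.vecMul_one,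
    vecMul_single', vecMul_single', mul_comm (v i)]
  congr 2
  ring

lemma rel_short_of_lt (v : Pos n → A) {i j : Pos n} (h : i.1 < j.1) (a : A) :
    Rel T v (v + Pi.single j (a * v i)
      - Pi.single (swap i) (sgn T A i j * a * v (swap j))) :=
  ⟨shortUnit T h.ne a, Subgroup.subset_closure (Or.inl ⟨i, j, a, h, rfl⟩), vecMul_shortGen v i j a⟩

/-- Adding `a v_i` to `v_j` and `∓ a v_σ(j)` to `v_σ(i)`. -/
lemma rel_short (v : Pos n → A) {i j : Pos n} (h : i.1 ≠ j.1) (a : A) :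
    Rel T v (v + Pi.single j (a * v i)
      - Pi.single (swap i) (sgn T A i j * a * v (swap j))) := by
  rcases lt_or_gt_of_ne h with h | h
  · exact rel_short_of_lt v h a
  -- Up to the sign of the parameter, the positions `(i, j)` and `(σ(j), σ(i))` define the same
  -- matrix, and passing from one to the other reverses the order of the pairs.
  · have := rel_short_of_lt (T := T) v (i := swap j) (j := swap i) h (-(sgn T A i j * a))
    convert this using 1
    rw [swap_swap, swap_swap, sgn_swap_swap]
    have : sgn T A i j * -(sgn T A i j * a) * v i = -(a * v i) := by
      linear_combination (-a * v i) * sgn_mul_self (T := T) (A := A) i j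
    rw [this, neg_mul, Pi.single_neg, Pi.single_neg]
    abel

lemma rel_long (v : Pos n → A) (i : Pos n) (a : A) :
    Rel .symplectic v (v + Pi.single (swap i) (a * v i)) := by
  refine ⟨longUnit i a, Subgroup.subset_closure (Or.inr ⟨rfl, i, a, rfl⟩), ?_⟩
  change v ᵥ* (1 + Matrix.single i (swap i) a) = _
  rw [Matrix.vecMul_add, Matrix.vecMul_one, vecMul_single', mul_comm]

/-- Adding the multiples `x_j v_i` to all `v_j` with `j` outside the pair of `i`, at the expense
of changing `v_σ(i)`. -/
lemma exists_rel_transvection (v x : Pos n → A) (i : Pos n) :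
    ∃ v' y, Rel T v v' ∧ v' i = v i ∧ (∀ j, j.1 ≠ i.1 → v' j = v j + x j * v i) ∧
      v' (swap i) = v (swap i)
        - ∑ j with j.1 ≠ i.1, sgn T A i j * x j * v (swap j) + y * v i ∧
      ((∀ j, x j * x (swap j) = 0) → y = 0) := by
  classical
  suffices H : ∀ s : Finset (Pos n), (∀ j ∈ s, j.1 ≠ i.1) →
      ∃ v' y, Rel T v v' ∧ v' i = v i ∧
        (∀ j, j.1 ≠ i.1 → v' j = v j + if j ∈ s then x j * v i else 0) ∧
        v' (swap i) = v (swap i) - ∑ j ∈ s, sgn T A i j * x j * v (swap j) + y * v i ∧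
        ((∀ j, x j * x (swap j) = 0) → y = 0) by
    obtain ⟨v', y, h1, h2, h3, h4⟩ := H {j | j.1 ≠ i.1} (by simp)
    refine ⟨v', y, h1, h2, fun j hj => ?_, h4⟩
    rw [h3 j hj, if_pos (by simpa using hj)]
  intro s
  induction s using Finset.induction_on with
  | empty => exact fun _ => ⟨v, 0, Rel.refl v, rfl, by simp, by simp, by simp⟩
  | insert j s hj ih =>
    intro hs
    obtain ⟨w, y, h1, h2, h3, h4, h5⟩ := ih fun j' hj' => hs j' (Finset.mem_insert_of_mem hj')
    have hji : j.1 ≠ i.1 := hs j (Finset.mem_insert_self j s)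
    have hsi : swap j ≠ i := fun e => hji (by rw [← e, swap_fst])
    have hne : j ≠ i := fun e => hji (by rw [e])
    have hne' : j ≠ swap i := fun e => hji (by rw [e, swap_fst])
    -- If `σ(j)` was treated before `j`, its entry already contains `x_σ(j) v_i`. This contributes a
    -- further multiple of `v_i` to the entry at `σ(i)`, which is recorded in `y`.
    refine ⟨_, y - sgn T A i j * (if swap j ∈ s then x j * x (swap j) else 0),
      h1.trans (rel_short w hji.symm (x j)), ?_, ?_, ?_, ?_⟩
    · simp [Pi.single_eq_of_ne (swap_ne i).symm, Pi.single_eq_of_ne hne.symm, h2]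
    · intro l hl
      have hl' : l ≠ swap i := fun e => hl (by rw [e, swap_fst])
      by_cases hlj : l = j
      · subst hlj
        simp [Pi.single_eq_of_ne hl', h2, h3 l hl, hj]
      · simp [Pi.single_eq_of_ne hl', h3 l hl, hlj]
    · have h6 := h3 (swap j) (by simpa using hji)
      simp only [Pi.sub_apply, Pi.add_apply, Pi.single_eq_same, Pi.single_eq_of_ne hne'.symm, h4,
        Finset.sum_insert hj, h6]
      split_ifs <;> ring
    · intro hx
      rw [h5 hx, hx j]
      simp

/-- The long generators change `v_σ(i)` by any multiple of `v_i`, so here the correction `y` can be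
prescribed. -/
lemma exists_rel_transvection_symplectic (v x : Pos n → A) (i : Pos n) (y : A) :
    ∃ v', Rel .symplectic v v' ∧ v' i = v i ∧ (∀ j, j.1 ≠ i.1 → v' j = v j + x j * v i) ∧
      v' (swap i) = v (swap i)
        - ∑ j with j.1 ≠ i.1, sgn .symplectic A i j * x j * v (swap j) + y * v i := by
  obtain ⟨w, z, h1, h2, h3, h4, -⟩ := exists_rel_transvection (T := .symplectic) v x i
  refine ⟨_, h1.trans (rel_long w i (y - z)), ?_, fun j hj => ?_, ?_⟩
  · simp [Pi.single_eq_of_ne (swap_ne i).symm, h2]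
  · have : j ≠ swap i := fun e => hj (by rw [e, swap_fst])
    simp [Pi.single_eq_of_ne this, h3 j hj]
  · simp only [Pi.add_apply, Pi.single_eq_same, h4, h2]
    ring

/-! ### Invariants of the action -/

/-- The quadratic form `∑ v_{2k-1} v_{2k}`. -/
def quad (v : Pos n → A) : A := ∑ k, v (k, 0) * v (k, 1)

/-- The pair of `j` gains `a v_i v_σ(j)` and the pair of `i` loses the same amount. -/
lemma quad_transvection (v : Pos n → A) {i j : Pos n} (h : i.1 ≠ j.1) (a : A) :
    quad (v + Pi.single j (a * v i) - Pi.single (swap i) (a * v (swap j))) = quad v := by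
  have key : ∀ k, (v + Pi.single j (a * v i) - Pi.single (swap i) (a * v (swap j)) : Pos n → A)
      (k, 0) * (v + Pi.single j (a * v i) - Pi.single (swap i) (a * v (swap j)) : Pos n → A)
      (k, 1) =
      v (k, 0) * v (k, 1) + ((if k = j.1 then a * v i * v (swap j) else 0) -
        (if k = i.1 then a * v i * v (swap j) else 0)) := by
    intro k
    obtain ⟨k₁, e⟩ := i
    obtain ⟨k₂, f⟩ := j
    simp only at h
    fin_cases e <;> fin_cases f <;> by_cases h₁ : k = k₁ <;> by_cases h₂ : k = k₂ <;>
      simp_all [swap, Fin.rev] <;> ring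
  rw [quad, Finset.sum_congr rfl fun k _ => key k, Finset.sum_add_distrib, Finset.sum_sub_distrib]
  simp [quad]

lemma vecMul_eq_of_mem_E (P : (Pos n → A) → Prop)
    (hP : ∀ v g, g ∈ elementaryGenerators T n A → (P (v ᵥ* g) ↔ P v))
    {v w : Pos n → A} (h : Rel T v w) : P w ↔ P v := by
  obtain ⟨g, hg, rfl⟩ := h
  induction hg using Subgroup.closure_induction generalizing v with
  | mem g hg => exact hP v _ hg
  | one => simp
  | mul g g' _ _ h h' =>
    rw [Units.val_mul, ← Matrix.vecMul_vecMul, h', h]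
  | inv g _ h =>
    rw [← h (v := v ᵥ* ((g⁻¹ : GL (Pos n) A) : Matrix (Pos n) (Pos n) A)), Matrix.vecMul_vecMul,
      ← Units.val_mul, inv_mul_cancel]
    simp

/-- The bilinear form only sees `2 * quad`. Invariance of `quad` itself is what later shows that `R`
has no 2-torsion. -/
lemma Rel.quad_eq {v w : Pos n → A} (h : Rel .orthogonal v w) : quad w = quad v := by
  refine (vecMul_eq_of_mem_E (T := .orthogonal) (fun u => quad u = quad v) ?_ h).2 rfl
  rintro u g (⟨i, j, a, hij, rfl⟩ | ⟨h, -⟩)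
  · have := quad_transvection u (h := hij.ne) a
    rw [vecMul_shortGen]
    simp only [sgn, one_mul, this]
  · cases h

lemma dotProduct_formMatrix (v : Pos n → A) :
    v ⬝ᵥ (formMatrix .orthogonal n A *ᵥ v) = 2 * quad v := by
  have : formMatrix .orthogonal n A *ᵥ v = fun i => v (swap i) := by
    ext i
    simp [formMatrix, Matrix.mulVec, dotProduct]
  rw [this, dotProduct, Fintype.sum_prod_type, quad, Finset.mul_sum]
  refine Finset.sum_congr rfl fun k _ => ?_
  rw [Fin.sum_univ_two, swap_mk_zero, swap_mk_one]
  ring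

lemma mem_Um_iff {v : Pos n → A} : v ∈ Um T n A ↔
    (∃ w : Pos n → A, v ⬝ᵥ w = 1) ∧ (T = .orthogonal → 2 * quad v = 0) := by
  constructor
  · rintro ⟨h, h'⟩
    refine ⟨h, ?_⟩
    rintro rfl
    rw [← dotProduct_formMatrix, h' rfl]
  · rintro ⟨h, h'⟩
    refine ⟨h, ?_⟩
    rintro rfl
    rw [dotProduct_formMatrix, h' rfl]

lemma Rel.mem_Um {v w : Pos n → A} (h : Rel T v w) (hv : v ∈ Um T n A) : w ∈ Um T n A := by
  rw [mem_Um_iff] at hv ⊢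
  obtain ⟨⟨u, hu⟩, hq⟩ := hv
  constructor
  · obtain ⟨g, hg, rfl⟩ := h
    refine ⟨((g⁻¹ : GL (Pos n) A) : Matrix (Pos n) (Pos n) A) *ᵥ u, ?_⟩
    rw [Matrix.dotProduct_mulVec, Matrix.vecMul_vecMul, ← Units.val_mul, mul_inv_cancel]
    simpa using hu
  · rintro rfl
    rw [h.quad_eq, hq rfl]

lemma single_mem_Um (i : Pos n) : (Pi.single i 1 : Pos n → A) ∈ Um T n A := by
  rw [mem_Um_iff]
  refine ⟨⟨Pi.single i 1, by simp⟩, fun _ => ?_⟩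
  rw [quad, Finset.sum_eq_zero, mul_zero]
  intro k _
  by_cases h : (k, (0 : Fin 2)) = i
  · have : ((k, 1) : Pos n) ≠ i := by rw [← h]; simp
    rw [Pi.single_eq_of_ne this, mul_zero]
  · rw [Pi.single_eq_of_ne h, zero_mul]

lemma trivialOrbitSpace_of_forall_rel (i : Pos n)
    (h : ∀ v ∈ Um T n A, Rel T v (Pi.single i 1)) : TrivialOrbitSpace T n A :=
  fun u hu v hv => (h u hu).trans (h v hv).symm

/-! ### Functoriality -/

variable {B : Type*} [CommRing B]

lemma map_mem_Um (f : A →+* B) {v : Pos n → A} (hv : v ∈ Um T n A) : f ∘ v ∈ Um T n B := by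
  rw [mem_Um_iff] at hv ⊢
  obtain ⟨⟨w, hw⟩, hq⟩ := hv
  refine ⟨⟨f ∘ w, by rw [← RingHom.map_dotProduct, hw, map_one]⟩, fun hT => ?_⟩
  have := congrArg f (hq hT)
  simpa [quad, map_ofNat] using this

lemma map_shortGen (f : A →+* B) (i j : Pos n) (a : A) :
    (shortGen T i j a).map f = shortGen T i j (f a) := by
  cases T <;> simp [shortGen, Matrix.map_sub, Matrix.map_add, Matrix.map_one, Matrix.map_single]

lemma map_mem_E (f : A →+* B) {g : GL (Pos n) A} (hg : g ∈ E T n A) :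
    Matrix.GeneralLinearGroup.map f g ∈ E T n B := by
  suffices E T n A ≤ (E T n B).comap (Matrix.GeneralLinearGroup.map f) from this hg
  refine (Subgroup.closure_le _).2 fun g hg => Subgroup.subset_closure ?_
  change (g : Matrix (Pos n) (Pos n) A).map f ∈ elementaryGenerators T n B
  rcases hg with ⟨i, j, a, hij, h⟩ | ⟨hT, i, a, h⟩
  · exact Or.inl ⟨i, j, f a, hij, by rw [h, map_shortGen]⟩
  · refine Or.inr ⟨hT, i, f a, ?_⟩
    rw [h]
    simp [Matrix.map_add, Matrix.map_one, Matrix.map_single]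

lemma map_vecMul (f : A →+* B) (v : Pos n → A) (g : GL (Pos n) A) :
    f ∘ (v ᵥ* (g : Matrix (Pos n) (Pos n) A)) =
      (f ∘ v) ᵥ* (Matrix.GeneralLinearGroup.map f g : Matrix (Pos n) (Pos n) B) := by
  ext i
  simp [RingHom.map_vecMul]

lemma Rel.map (f : A →+* B) {u v : Pos n → A} (h : Rel T u v) : Rel T (f ∘ u) (f ∘ v) := by
  obtain ⟨g, hg, rfl⟩ := h
  exact ⟨_, map_mem_E f hg, (map_vecMul f u g).symm⟩

lemma mem_Um_of_map (f : A →+* B) (hf : Function.Injective f) {v : Pos n → A}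
    (hv : f ∘ v ∈ Um T n B) (h : ∃ w : Pos n → A, v ⬝ᵥ w = 1) : v ∈ Um T n A := by
  rw [mem_Um_iff] at hv ⊢
  refine ⟨h, fun hT => hf ?_⟩
  simpa [quad, map_ofNat] using hv.2 hT

/-- A row congruent to a unit vector modulo `h` and unimodular over a ring is already unimodular
over a subring containing enough multiples of `h`. -/
lemma exists_dotProduct_eq_one (f : A →+* B) (hf : Function.Injective f) {v : Pos n → A}
    {w : Pos n → B} (hw : (f ∘ v) ⬝ᵥ w = 1) (i : Pos n) (N : ℕ)
    (h : ∀ j, w j * (f (1 - v i)) ^ N ∈ Set.range f) : ∃ w : Pos n → A, v ⬝ᵥ w = 1 := by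
  choose u hu using h
  -- The part `u` has product `(1 - v_i)^N` with `v`; the geometric sum, multiplied by `v_i`,
  -- supplies the missing `1 - (1 - v_i)^N`.
  refine ⟨u + Pi.single i (∑ l ∈ Finset.range N, (1 - v i) ^ l), hf ?_⟩
  rw [dotProduct_add, dotProduct_single, map_add, map_one, RingHom.map_dotProduct]
  have h1 : f ∘ u = (f (1 - v i)) ^ N • w := by
    ext j
    simp [hu, mul_comm]
  have h2 := mul_neg_geom_sum (1 - v i) N
  rw [h1, dotProduct_smul, hw, ← map_pow, smul_eq_mul, mul_one, ← map_add, ← map_one f]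
  congr 1
  rw [sub_sub_cancel] at h2
  rw [h2]
  ring

end Orbits

/-! ### Stable range and prime avoidance -/

section CommutativeAlgebra

variable {A : Type*} [CommRing A]

/-- After localization at `Q`, the element `a` is nilpotent modulo `I`. Otherwise some prime over
`I` would avoid both `a` and the complement of `Q`, and so be strictly smaller than `Q`. -/
lemma Ideal.exists_mul_mem_radical_of_mem_minimalPrimes {I Q : Ideal A} (hQ : Q ∈ I.minimalPrimes)
    {a : A} (ha : a ∈ Q) : ∃ y ∉ Q, y * a ∈ I.radical := by
  have : Q.IsPrime := hQ.1.1
  by_contra! H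
  have hd : Disjoint (I.radical : Set A) (Submonoid.powers a ⊔ Q.primeCompl : Submonoid A) := by
    rw [Set.disjoint_left]
    intro x hx hx'
    obtain ⟨y, ⟨k, rfl⟩, z, hz, rfl⟩ := Submonoid.mem_sup.1 hx'
    refine H z hz ?_
    have h1 : (z * a) ^ (k + 1) ∈ I.radical := by
      have : (z * a) ^ (k + 1) = (z ^ k * a) * ((fun x ↦ a ^ x) k * z) := by simp only; ring
      rw [this]
      exact Ideal.mul_mem_left _ _ hx
    exact I.radical_isRadical ⟨_, h1⟩
  obtain ⟨P, hP, hIP, hdP⟩ := Ideal.exists_le_prime_disjoint _ _ hd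
  have hPQ : P ≤ Q := fun x hx => by
    by_contra hxQ
    exact Set.disjoint_left.1 hdP hx (Submonoid.mem_sup_right (S := Submonoid.powers a) hxQ)
  have hQP := hQ.2 ⟨hP, I.le_radical.trans hIP⟩ hPQ
  exact Set.disjoint_left.1 hdP (hQP ha)
    (Submonoid.mem_sup_left (Submonoid.mem_powers a))

/-- Basic elements: if the primes disjoint from `S` have height at most `d` and those of them which
contain `I`, but not `b`, have height at least `k`, then `d + 1 - k` elements `a_j` can be changed
by multiples of `b` such that `b` lies in all primes disjoint from `S` containing `I` and
the `a_j`. -/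
lemma exists_forall_prime_mem {ι : Type*} (S : Submonoid A) (d : ℕ)
    (hd : ∀ P : Ideal A, P.IsPrime → Disjoint (P : Set A) S → P.height ≤ d) (a : ι → A) (b : A)
    (s : Finset ι) : ∀ (I : Ideal A) (k : ℕ),
    (∀ P : Ideal A, P.IsPrime → Disjoint (P : Set A) S → I ≤ P → b ∉ P → (k : ℕ∞) ≤ P.height) →
    d + 1 ≤ s.card + k →
    ∃ x : ι → A, ∀ P : Ideal A, P.IsPrime → Disjoint (P : Set A) S → I ≤ P →
      (∀ j ∈ s, a j + x j * b ∈ P) → b ∈ P := by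
  classical
  induction s using Finset.induction_on with
  | empty =>
    refine fun I k hk hdk => ⟨0, fun P hP hPS hIP _ => ?_⟩
    by_contra hb
    have h1 := (hk P hP hPS hIP hb).trans (hd P hP hPS)
    have h2 : k ≤ d := by exact_mod_cast h1
    simp at hdk
    omega
  | insert l s hl ih =>
    intro I k hk hdk
    -- `C` is the colon ideal `(rad I : a_l)`. A prime containing `I`, `a_l` and `C` cannot be
    -- minimal over `I`, so passing from `I` to `J` raises the height bound from `k` to `k + 1` and
    -- pays for the element `a_l`.
    set C : Ideal A := Submodule.comap (LinearMap.mulRight A (a l)) I.radical with hC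
    set J : Ideal A := (I ⊔ Ideal.span {a l}) ⊔ C with hJ
    have hCmem : ∀ y, y ∈ C ↔ y * a l ∈ I.radical := fun y => Iff.rfl
    have hIJ : I ≤ J := le_sup_left.trans le_sup_left
    obtain ⟨x, hx⟩ := ih J (k + 1) (by
      intro P hP hPS hJP hbP
      obtain ⟨Q, hQ, hQP⟩ := Ideal.exists_minimalPrimes_le (hIJ.trans hJP)
      have hQp : Q.IsPrime := hQ.1.1
      have hne : Q ≠ P := by
        rintro rfl
        have ha : a l ∈ Q := hJP (le_sup_left (α := Ideal A) (le_sup_right (α := Ideal A)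
          (Ideal.subset_span rfl)))
        obtain ⟨y, hy, hya⟩ := Ideal.exists_mul_mem_radical_of_mem_minimalPrimes hQ ha
        exact hy (hJP (le_sup_right (α := Ideal A) hya))
      have h1 := hk Q hQp (hPS.mono_left hQP) hQ.1.2 fun h => hbP (hQP h)
      have h2 := Ideal.height_add_one_le_of_lt_of_isPrime (lt_of_le_of_ne hQP hne)
      push_cast
      exact (add_le_add_left h1 1).trans h2) (by
        rw [Finset.card_insert_of_notMem hl] at hdk; omega)
    set K : Ideal A := (I ⊔ Ideal.span {a l} ⊔ Ideal.span ((fun j => a j + x j * b) '' s)) ⊔ C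
      with hK
    -- By induction no prime over `K` avoids both `S` and `b`. Writing an element `t = s b^m` of `K`
    -- as `z + y` with `y ∈ C` produces the multiplier `y` for `a_l`.
    obtain ⟨t, htK, htS⟩ : ∃ t ∈ K, t ∈ S ⊔ Submonoid.powers b := by
      by_contra! H
      obtain ⟨P, hP, hKP, hdP⟩ := Ideal.exists_le_prime_disjoint K (S ⊔ Submonoid.powers b)
        (Set.disjoint_left.2 H)
      refine Set.disjoint_left.1 hdP (hx P hP (hdP.mono_right ?_) (le_trans ?_ hKP) fun j hj =>
        hKP (le_sup_left (α := Ideal A) (le_sup_right (α := Ideal A) (Ideal.subset_span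
          ⟨j, hj, rfl⟩)))) (Submonoid.mem_sup_right (Submonoid.mem_powers b))
      · exact SetLike.coe_subset_coe.2 le_sup_left
      · exact sup_le_sup le_sup_left le_rfl
    obtain ⟨z, hz, y, hy, hzy⟩ := Submodule.mem_sup.1 htK
    obtain ⟨u, huS, w, ⟨m, rfl⟩, huw⟩ := Submonoid.mem_sup.1 htS
    -- Since `y * a_l` lies in every prime over `I`, a prime containing `a_l + y * b` but not `b`
    -- contains both `a_l` and `y`, hence also `t`.
    refine ⟨fun j => if j = l then y else x j, fun P hP hPS hIP hP' => ?_⟩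
    by_contra hb
    have h1 : y * a l ∈ P := (hP.radical_le_iff.2 hIP) hy
    have h2 : a l + y * b ∈ P := by simpa using hP' l (Finset.mem_insert_self l s)
    have h3 : a l ∈ P ∧ y ∈ P := by
      rcases hP.mem_or_mem h1 with h | h
      · refine ⟨?_, h⟩
        have := P.sub_mem h2 (P.mul_mem_right b h)
        simpa using this
      · refine ⟨h, (hP.mem_or_mem (?_ : y * b ∈ P)).resolve_right hb⟩
        have := P.sub_mem h2 h
        simpa using this
    have hzP : z ∈ P := by
      refine (sup_le (sup_le hIP ?_) ?_ : _ ≤ P) hz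
      · rw [Ideal.span_le]
        rintro _ rfl
        exact h3.1
      · rw [Ideal.span_le]
        rintro _ ⟨j, hj, rfl⟩
        have : a j + (if j = l then y else x j) * b ∈ P := hP' j (Finset.mem_insert_of_mem hj)
        rwa [if_neg (by rintro rfl; exact hl hj)] at this
    have htP : t ∈ P := hzy ▸ P.add_mem hzP h3.2
    rw [← huw] at htP
    rcases hP.mem_or_mem htP with h | h
    · exact Set.disjoint_left.1 hPS h huS
    · exact hb (hP.mem_of_pow_mem m h)

lemma exists_mem_span_of_forall_prime (S : Submonoid A) (I : Ideal A)
    (h : ∀ P : Ideal A, P.IsPrime → Disjoint (P : Set A) S → ¬ I ≤ P) : ∃ s ∈ S, s ∈ I := by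
  by_contra! H
  obtain ⟨P, hP, hIP, hdP⟩ := Ideal.exists_le_prime_disjoint I S
    (Set.disjoint_right.2 H)
  exact h P hP hdP hIP

/-- Prime avoidance for cosets. -/
lemma exists_add_notMem (F : Finset (Ideal A)) (hF : ∀ Q ∈ F, Q.IsPrime)
    (hinc : ∀ Q ∈ F, ∀ Q' ∈ F, Q ≤ Q' → Q = Q') (a : A) (J : Ideal A)
    (h : ∀ Q ∈ F, a ∈ Q → ¬ J ≤ Q) : ∃ z ∈ J, ∀ Q ∈ F, a + z ∉ Q := by
  classical
  obtain ⟨F₁, hF₁⟩ : ∃ F₁ : Finset (Ideal A), ∀ Q, Q ∈ F₁ ↔ Q ∈ F ∧ a ∈ Q :=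
    ⟨F.filter (a ∈ ·), fun Q => Finset.mem_filter⟩
  obtain ⟨F₂, hF₂⟩ : ∃ F₂ : Finset (Ideal A), ∀ Q, Q ∈ F₂ ↔ Q ∈ F ∧ a ∉ Q :=
    ⟨F.filter (a ∉ ·), fun Q => Finset.mem_filter⟩
  -- The correction `z` is taken in `J` and in all `Q` not containing `a`, but outside all `Q`
  -- containing `a`. Incomparability makes this possible.
  have h1 : ¬ (((J * ∏ Q ∈ F₂, Q : Ideal A) : Set A) ⊆
      ⋃ Q ∈ (F₁ : Set (Ideal A)), (id Q : Ideal A)) := by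
    intro hsub
    obtain ⟨Q, hQ, hKQ⟩ := (Ideal.subset_union_prime (f := id) ⊤ ⊤
      (fun Q hQ _ _ => hF Q ((hF₁ Q).1 hQ).1)).1 hsub
    obtain ⟨hQF, haQ⟩ := (hF₁ Q).1 hQ
    have hQp := hF Q hQF
    rcases hQp.mul_le.1 hKQ with h2 | h2
    · exact h Q hQF haQ h2
    · obtain ⟨Q', hQ', hle⟩ := (Ideal.IsPrime.prod_le hQp).1 h2
      obtain ⟨hQ'F, haQ'⟩ := (hF₂ Q').1 hQ'
      exact haQ' (hinc Q' hQ'F Q hQF hle ▸ haQ)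
  obtain ⟨z, hzK, hz⟩ := Set.not_subset.1 h1
  refine ⟨z, Ideal.mul_le_left hzK, fun Q hQ hQ' => ?_⟩
  by_cases haQ : a ∈ Q
  · refine hz (Set.mem_biUnion (Finset.mem_coe.2 ((hF₁ Q).2 ⟨hQ, haQ⟩)) ?_)
    have := Q.sub_mem hQ' haQ
    rwa [add_sub_cancel_left] at this
  · have hzQ : z ∈ Q := by
      have h2 : J * ∏ Q ∈ F₂, Q ≤ Q := Ideal.mul_le_right.trans
        (Ideal.prod_le_inf.trans (Finset.inf_le ((hF₂ Q).2 ⟨hQ, haQ⟩)))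
      exact h2 hzK
    have := Q.sub_mem hQ' hzQ
    rw [add_sub_cancel_right] at this
    exact haQ this

/-! ### Heights of primes in polynomial rings -/

open Polynomial in
-- Such a prime survives in the polynomial ring over the fraction field of `B`, which has dimension
-- one.
lemma height_le_one_of_comap_eq_bot {B : Type*} [CommRing B] [IsDomain B] [IsNoetherianRing B]
    (Q : Ideal B[X]) [Q.IsPrime] (h : Q.comap C = ⊥) : Q.height ≤ 1 := by
  let _ : Algebra B[X] (FractionRing B)[X] := Polynomial.algebra B (FractionRing B)
  have _ : IsLocalization ((nonZeroDivisors B).map (C : B →+* B[X])) (FractionRing B)[X] :=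
    Polynomial.isLocalization (nonZeroDivisors B) (FractionRing B)
  have hd : Disjoint (((nonZeroDivisors B).map (C : B →+* B[X]) : Submonoid B[X]) : Set B[X])
      (Q : Set B[X]) := by
    rw [Set.disjoint_left]
    rintro _ ⟨b, hb, rfl⟩ hbQ
    have : b ∈ Q.comap C := hbQ
    rw [h] at this
    exact nonZeroDivisors.ne_zero hb this
  rw [← IsLocalization.height_map_of_disjoint (S := (FractionRing B)[X])
    ((nonZeroDivisors B).map (C : B →+* B[X])) Q hd]
  have hp := IsLocalization.isPrime_of_isPrime_disjoint ((nonZeroDivisors B).map (C : B →+* B[X]))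
    (FractionRing B)[X] Q inferInstance hd
  have h1 := Ideal.height_le_ringKrullDim_of_isPrime
    (I := Q.map (algebraMap B[X] (FractionRing B)[X]))
  have h2 : ringKrullDim (FractionRing B)[X] = 1 := by
    rw [Polynomial.ringKrullDim_of_isNoetherianRing, ringKrullDim_eq_zero_of_field, zero_add]
  rw [h2] at h1
  exact_mod_cast h1

open Polynomial in
-- Modulo the extension of `p = P ∩ A`, the prime becomes one of `(A/p)[X]` lying over zero, so the
-- fibre contributes at most one.
lemma height_le_height_comap_add_one [IsNoetherianRing A] (P : Ideal A[X]) [P.IsPrime] :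
    P.height ≤ (P.comap C).height + 1 := by
  set p : Ideal A := P.comap C with hp
  have : P.LiesOver p := ⟨rfl⟩
  refine (Ideal.height_le_height_add_of_liesOver p P).trans (add_le_add_right ?_ _)
  set I : Ideal A[X] := p.map (algebraMap A A[X]) with hI
  have hIP : I ≤ P := Ideal.map_le_iff_le_comap.2 le_rfl
  let e : (A[X] ⧸ I) ≃+* (A ⧸ p)[X] := (Ideal.polynomialQuotientEquivQuotientPolynomial p).symm
  set Q' := P.map (Ideal.Quotient.mk I) with hQ'
  have hQ'p : Q'.IsPrime := Ideal.map_isPrime_of_surjective Ideal.Quotient.mk_surjective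
    (by rwa [Ideal.mk_ker])
  set Q := Q'.map e with hQ
  have hQp : Q.IsPrime := Ideal.map_isPrime_of_equiv e
  rw [← e.height_map Q']
  refine height_le_one_of_comap_eq_bot Q ?_
  rw [eq_bot_iff]
  intro x hx
  obtain ⟨a, rfl⟩ := Ideal.Quotient.mk_surjective x
  have h1 : C (Ideal.Quotient.mk p a) = e (Ideal.Quotient.mk I (C a)) := by
    rw [RingEquiv.eq_symm_apply, ← Polynomial.map_C]
    exact Ideal.polynomialQuotientEquivQuotientPolynomial_map_mk p (C a)
  have h2 : e (Ideal.Quotient.mk I (C a)) ∈ Q := h1 ▸ hx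
  rw [hQ, Ideal.mem_map_of_equiv] at h2
  obtain ⟨y, hy, hye⟩ := h2
  rw [e.injective hye] at hy
  have h3 : C a ∈ P := by
    have := (Ideal.mem_map_iff_of_surjective _ Ideal.Quotient.mk_surjective).1 hy
    obtain ⟨z, hz, hz'⟩ := this
    have := hIP (Ideal.Quotient.eq.1 hz'.symm)
    have := P.add_mem this hz
    simpa using this
  exact (Ideal.Quotient.eq_zero_iff_mem).2 h3

open Polynomial in
lemma height_map_C_le [IsNoetherianRing A] (p : Ideal A) [p.IsPrime] :
    (p.map (C : A →+* A[X])).height ≤ p.height := by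
  have hP : (p.map (C : A →+* A[X])).IsPrime := Ideal.isPrime_map_C_of_isPrime
  have : (p.map (C : A →+* A[X])).LiesOver p := by
    refine ⟨le_antisymm Ideal.le_comap_map fun a ha => ?_⟩
    have := Ideal.mem_map_C_iff.1 ha 0
    simpa using this
  refine (Ideal.height_le_height_add_of_liesOver p (p.map (C : A →+* A[X]))).trans ?_
  have h1 : (p.map (C : A →+* A[X])).map (Ideal.Quotient.mk (p.map (algebraMap A A[X]))) = ⊥ :=
    Ideal.map_quotient_self _
  have : Nontrivial (A[X] ⧸ p.map (algebraMap A A[X])) :=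
    Ideal.Quotient.nontrivial_iff.2 hP.ne_top
  rw [h1, Ideal.height_bot, add_zero]

open LaurentPolynomial in
/-- Laurent polynomials whose lowest coefficient lies in `S`. -/
def lowestCoeffSubmonoid (S : Submonoid A) : Submonoid A[T;T⁻¹] where
  carrier := {f | ∃ k : ℤ, f.coeff k ∈ S ∧ ∀ l < k, f.coeff l = 0}
  one_mem' := by
    refine ⟨0, ?_, fun l hl => ?_⟩
    · rw [AddMonoidAlgebra.one_def]
      simp
    · rw [AddMonoidAlgebra.one_def, AddMonoidAlgebra.coeff_single, Finsupp.single_eq_of_ne hl.ne]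
  mul_mem' := by
    rintro f g ⟨k, hk, hk'⟩ ⟨l, hl, hl'⟩
    refine ⟨k + l, ?_, fun m hm => ?_⟩
    · rw [AddMonoidAlgebra.coeff_mul, Finsupp.sum, Finset.sum_eq_single k]
      · rw [Finsupp.sum, Finset.sum_eq_single l]
        · simpa using S.mul_mem hk hl
        · intro b _ hb
          rw [if_neg (by simpa using hb)]
        · intro h
          simp [Finsupp.notMem_support_iff.1 h]
      · intro b hb hbk
        refine Finset.sum_eq_zero fun c hc => ?_
        by_cases h : b + c = k + l
        · have hb' : k ≤ b := by
            by_contra! hlt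
            exact (Finsupp.mem_support_iff.1 hb) (hk' b hlt)
          have hc' : l ≤ c := by
            by_contra! hlt
            exact (Finsupp.mem_support_iff.1 hc) (hl' c hlt)
          omega
        · exact if_neg h
      · intro h
        simp [Finsupp.notMem_support_iff.1 h]
    · rw [AddMonoidAlgebra.coeff_mul]
      refine Finset.sum_eq_zero fun b hb => Finset.sum_eq_zero fun c hc => ?_
      have hb' : k ≤ b := by
        by_contra! hlt
        exact (Finsupp.mem_support_iff.1 hb) (hk' b hlt)
      have hc' : l ≤ c := by
        by_contra! hlt
        exact (Finsupp.mem_support_iff.1 hc) (hl' c hlt)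
      exact if_neg (by change ¬ b + c = m; omega)

open LaurentPolynomial in
-- Adjoining a Laurent variable does not raise the bound. If the contraction `P` to `A[X]` is not
-- extended from `p = P ∩ A`, its height may exceed that of `p` by one; but then the constant
-- coefficients of elements of `P` provide a prime `q` strictly above `p` and still disjoint from
-- `S`, which makes up for the loss.
lemma height_le_of_disjoint_lowestCoeffSubmonoid [IsNoetherianRing A] (S : Submonoid A) (d : ℕ)
    (hd : ∀ P : Ideal A, P.IsPrime → Disjoint (P : Set A) S → P.height ≤ d)
    (P' : Ideal A[T;T⁻¹]) (hP' : P'.IsPrime)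
    (hdis : Disjoint (P' : Set A[T;T⁻¹]) (lowestCoeffSubmonoid S)) : P'.height ≤ d := by
  rw [← IsLocalization.height_under (Submonoid.powers (Polynomial.X : Polynomial A)) P']
  set P : Ideal (Polynomial A) := P'.under (Polynomial A) with hP
  have hPp : P.IsPrime := inferInstance
  have hmem : ∀ f : Polynomial A, f ∈ P ↔ Polynomial.toLaurent f ∈ P' := fun f => Iff.rfl
  have hX : Polynomial.X ∉ P := by
    rw [hmem, Polynomial.toLaurent_X]
    exact fun h => hP'.ne_top (Ideal.eq_top_of_isUnit_mem _ h (isUnit_T 1))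
  have hg : ∀ g ∈ P, g.coeff 0 ∉ S := by
    intro g hgP hgS
    refine Set.disjoint_left.1 hdis ((hmem g).1 hgP) ⟨0, ?_, fun l hl => ?_⟩
    · rw [LaurentPolynomial.coeff_toLaurent]
      have := Finsupp.mapDomain_apply Nat.castEmbedding.injective g.toFinsupp.coeff 0 (β := ℤ)
      rw [show (0 : ℤ) = (Nat.castEmbedding : ℕ ↪ ℤ) 0 from rfl, this]
      exact hgS
    · rw [LaurentPolynomial.coeff_toLaurent]
      refine Finsupp.mapDomain_of_notMem_range _ _ ?_
      rintro ⟨m, rfl⟩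
      simp at hl
      omega
  set p : Ideal A := P.comap Polynomial.C with hp
  have hpd : Disjoint (p : Set A) S := by
    rw [Set.disjoint_left]
    intro a ha haS
    exact hg (Polynomial.C a) ha (by simpa using haS)
  by_cases hcase : P ≤ p.map Polynomial.C
  · exact (Ideal.height_mono hcase).trans ((height_map_C_le p).trans (hd p inferInstance hpd))
  obtain ⟨f, hfP, hf⟩ := SetLike.not_le_iff_exists.1 hcase
  -- If all constant coefficients were in `p`, one could subtract them and divide by `X ∉ P`; by
  -- induction on the degree, `P` would be extended from `p`.
  obtain ⟨h, hhP, hh⟩ : ∃ h ∈ P, h.coeff 0 ∉ p := by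
    by_contra! H
    refine hf ?_
    have key : ∀ m : ℕ, ∀ f ∈ P, f.natDegree < m → f ∈ p.map Polynomial.C := by
      intro m
      induction m with
      | zero => intro f _ h; omega
      | succ m ih =>
        intro f hfP hfm
        have h0 : Polynomial.C (f.coeff 0) ∈ p.map (Polynomial.C : A →+* Polynomial A) :=
          Ideal.mem_map_of_mem _ (H f hfP)
        have h1 : Polynomial.X * f.divX ∈ P := by
          have := P.sub_mem hfP (H f hfP : Polynomial.C (f.coeff 0) ∈ P)
          rwa [sub_eq_of_eq_add f.X_mul_divX_add.symm] at this
        have h2 := (hPp.mem_or_mem h1).resolve_left hX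
        rw [← f.X_mul_divX_add]
        refine Ideal.add_mem _ (Ideal.mul_mem_left _ _ ?_) h0
        by_cases hm : f.natDegree = 0
        · have : f.divX = 0 := by
            rw [Polynomial.eq_C_of_natDegree_eq_zero hm, Polynomial.divX_C]
          rw [this]
          exact Ideal.zero_mem _
        · exact ih _ h2 (by rw [Polynomial.natDegree_divX_eq_natDegree_tsub_one]; omega)
    exact key _ f hfP (Nat.lt_succ_self _)
  -- Every element of `p + (h(0))` is the constant coefficient of an element of `P`.
  have hq : Disjoint ((p ⊔ Ideal.span {h.coeff 0} : Ideal A) : Set A) S := by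
    rw [Set.disjoint_left]
    intro s hs hsS
    obtain ⟨c, hc, y, hy, rfl⟩ := Submodule.mem_sup.1 hs
    obtain ⟨b, rfl⟩ := Ideal.mem_span_singleton'.1 hy
    refine hg (Polynomial.C c + Polynomial.C b * h) (P.add_mem hc (P.mul_mem_left _ hhP)) ?_
    simpa using hsS
  obtain ⟨q, hqp, hle, hqd⟩ := Ideal.exists_le_prime_disjoint _ _ hq
  have hlt : p < q := lt_of_le_of_ne (le_sup_left.trans hle) fun e =>
    hh (e ▸ hle (le_sup_right (α := Ideal A) (Ideal.subset_span rfl)))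
  calc P.height ≤ p.height + 1 := height_le_height_comap_add_one P
    _ ≤ q.height := Ideal.height_add_one_le_of_lt_of_isPrime hlt
    _ ≤ d := hd q hqp hqd

end CommutativeAlgebra

/-! ### Moving a coordinate into a multiplicative set -/

section Stability

variable {T : ClassicalType} {n : ℕ} {A : Type*} [CommRing A]

/-- This is the transvection based at `σ(i)`, read off at the coordinate `i`: the entry at the base
stays fixed and that at `i` absorbs a combination of the entries in other pairs. -/
lemma exists_rel_add_sum (v c : Pos n → A) (i : Pos n) :
    ∃ v' y, Rel T v v' ∧ v' (swap i) = v (swap i) ∧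
      v' i = v i + ∑ j with j.1 ≠ i.1, c j * v j + y * v (swap i) ∧
      ((∀ j, c j * c (swap j) = 0) → y = 0) := by
  obtain ⟨v', y, h1, h2, -, h4, h5⟩ := exists_rel_transvection (T := T) v
    (fun j => -(sgn T A (swap i) j * c (swap j))) (swap i)
  refine ⟨v', y, h1, h2, ?_, fun hc => h5 fun j => ?_⟩
  · rw [swap_swap] at h4
    rw [h4, sub_eq_add_neg, ← Finset.sum_neg_distrib]
    congr 2
    refine Finset.sum_nbij' swap swap
      (fun j hj => Finset.mem_filter.2 ⟨Finset.mem_univ _, (Finset.mem_filter.1 hj).2⟩)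
      (fun j hj => Finset.mem_filter.2 ⟨Finset.mem_univ _, (Finset.mem_filter.1 hj).2⟩)
      (by simp) (by simp) fun j _ => ?_
    linear_combination c (swap j) * v (swap j) * sgn_mul_self (T := T) (A := A) (swap i) j
  · rw [swap_swap]
    linear_combination sgn T A (swap i) j * sgn T A (swap i) (swap j) * hc j

lemma forall_prime_not_of_dotProduct {v w : Pos n → A} (h : v ⬝ᵥ w = 1) (P : Ideal A)
    (hP : P.IsPrime) : ¬ ∀ i, v i ∈ P := fun H =>
  hP.ne_top ((Ideal.eq_top_iff_one P).2 (h ▸ P.sum_mem fun i _ => P.mul_mem_right _ (H i)))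

lemma exists_dotProduct_of_rel {v v' w : Pos n → A} (h : Rel T v v') (hw : v ⬝ᵥ w = 1) :
    ∃ w', v' ⬝ᵥ w' = 1 := by
  obtain ⟨g, hg, rfl⟩ := h
  refine ⟨((g⁻¹ : GL (Pos n) A) : Matrix (Pos n) (Pos n) A) *ᵥ w, ?_⟩
  rw [Matrix.dotProduct_mulVec, Matrix.vecMul_vecMul, ← Units.val_mul, mul_inv_cancel]
  simpa using hw

/-- The `2n - 1 ≥ d + 1` coordinates other than `v_i` can be changed by multiples of `v_i` so that
their ideal meets `S`. An element `s` of the intersection is then a combination of these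
coordinates, and any multiple of it can be added to the `i`-th one. -/
lemma exists_rel_add_mul_symplectic (S : Submonoid A) (d : ℕ) (hn : d + 2 ≤ 2 * n)
    (hd : ∀ P : Ideal A, P.IsPrime → Disjoint (P : Set A) S → P.height ≤ d)
    {v w : Pos n → A} (hw : v ⬝ᵥ w = 1) (i : Pos n) :
    ∃ v', Rel .symplectic v v' ∧ ∃ s ∈ S, ∀ t, ∃ v'', Rel .symplectic v' v'' ∧
      v'' i = v' i + t * s := by
  obtain ⟨x, hx⟩ := exists_forall_prime_mem S d hd v (v i) (Finset.univ.erase i) ⊥ 0 (by simp)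
    (by rw [Finset.card_erase_of_mem (Finset.mem_univ i)]; simp; omega)
  obtain ⟨s, hsS, hs⟩ := exists_mem_span_of_forall_prime S
    (Ideal.span ((fun j => v j + x j * v i) '' {j | j ≠ i})) (fun P hP hPS hle => by
      have h1 : ∀ j, j ≠ i → v j + x j * v i ∈ P := fun j hj =>
        hle (Ideal.subset_span ⟨j, hj, rfl⟩)
      have h2 := hx P hP hPS bot_le (fun j hj => h1 j (Finset.ne_of_mem_erase hj))
      refine forall_prime_not_of_dotProduct hw P hP fun j => ?_
      by_cases hj : j = i
      · rwa [hj]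
      · simpa using P.sub_mem (h1 j hj) (P.mul_mem_left (x j) h2))
  -- The free parameter is chosen so that the new entry at `σ(i)` is the desired `v_σ(i) + x_σ(i)
  -- v_i` up to a combination of the other new entries; the ideal generated is therefore large
  -- enough.
  obtain ⟨v', h1, h2, h3, h4⟩ := exists_rel_transvection_symplectic v x i
    (x (swap i) - ∑ j with j.1 ≠ i.1, sgn .symplectic A i j * x j * x (swap j))
  have h5 : v' (swap i) = v (swap i) + x (swap i) * v i -
      ∑ j with j.1 ≠ i.1, sgn .symplectic A i j * x j * v' (swap j) := by
    have : ∑ j with j.1 ≠ i.1, sgn .symplectic A i j * x j * v' (swap j) =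
        ∑ j with j.1 ≠ i.1, sgn .symplectic A i j * x j * v (swap j) +
        (∑ j with j.1 ≠ i.1, sgn .symplectic A i j * x j * x (swap j)) * v i := by
      rw [Finset.sum_mul, ← Finset.sum_add_distrib]
      refine Finset.sum_congr rfl fun j hj => ?_
      rw [h3 (swap j) (by simpa using hj)]
      ring
    rw [h4, this]
    ring
  have h6 : s ∈ Ideal.span (Set.range fun j => if j = i then 0 else v' j) := by
    set I := Ideal.span (Set.range fun j => if j = i then 0 else v' j)
    have hI : ∀ j, j ≠ i → v' j ∈ I := fun j hj => Ideal.subset_span ⟨j, by simp [hj]⟩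
    refine (Ideal.span_le.2 ?_ : _ ≤ I) hs
    rintro _ ⟨j, hj, rfl⟩
    by_cases hji : j.1 = i.1
    · obtain rfl := (eq_or_eq_swap hji).resolve_left hj
      have := I.add_mem (hI _ hj) (I.sum_mem fun (l : Pos n)
        (hl : l ∈ Finset.univ.filter fun l : Pos n => l.1 ≠ i.1) =>
        I.mul_mem_left (sgn .symplectic A i l * x l) (hI (swap l) fun e =>
          (Finset.mem_filter.1 hl).2 (by rw [← e, swap_fst])))
      rw [h5, sub_add_cancel] at this
      exact this
    · simp only [SetLike.mem_coe]
      rw [← h3 j hji]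
      exact hI j hj
  obtain ⟨c, hc⟩ := (Ideal.mem_span_range_iff_exists_fun).1 h6
  refine ⟨v', h1, s, hsS, fun t => ?_⟩
  obtain ⟨v'', y, k1, k2, k3, -⟩ := exists_rel_add_sum (T := .symplectic) v' (fun j => t * c j) i
  refine ⟨_, k1.trans (rel_long v'' (swap i) (t * c (swap i) - y)), ?_⟩
  have h7 : s = ∑ j with j.1 ≠ i.1, c j * v' j + c (swap i) * v' (swap i) := by
    rw [← hc, ← Finset.sum_filter_add_sum_filter_not Finset.univ (fun j : Pos n => j.1 ≠ i.1)]
    congr 1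
    · refine Finset.sum_congr rfl fun j hj => ?_
      rw [if_neg]
      rintro rfl
      simp at hj
    · rw [Finset.sum_eq_single (swap i), if_neg (swap_ne i)]
      · intro j hj hj'
        rw [if_pos ((eq_or_eq_swap (by simpa using hj)).resolve_right hj'), mul_zero]
      · simp
  rw [swap_swap, Pi.add_apply, Pi.single_eq_same, k3, k2, h7, mul_add, Finset.mul_sum]
  simp only [mul_assoc]
  ring

/-- The primes containing the first `k` even coordinates, but not all of them, have height at
least `k`. -/
def GenericUpTo (k : ℕ) (v : Pos n → A) : Prop :=
  ∀ P : Ideal A, P.IsPrime → (∀ l : Fin n, l < k → v (l, 1) ∈ P) → (¬ ∀ l, v (l, 1) ∈ P) →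
    (k : ℕ∞) ≤ P.height

/-- The entries `v (k, 1)` are treated in increasing order of `k`. Adding to `v (k, 1)` a
combination of the later `v (l, 1)` moves it out of every minimal prime over the earlier ones,
except those primes that contain all of them. This raises the height by one at each step. -/
lemma exists_rel_genericUpTo [IsNoetherianRing A] (v : Pos n → A) (m : ℕ) (hm : m ≤ n) :
    ∃ v', Rel .orthogonal v v' ∧ ∀ k ≤ m, GenericUpTo k v' := by
  classical
  induction m with
  | zero => exact ⟨v, Rel.refl v, fun k hk P _ _ _ => by simp [Nat.le_zero.1 hk]⟩
  | succ m ih =>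
    obtain ⟨u, hu, hgen⟩ := ih (by omega)
    set k : Fin n := ⟨m, hm⟩ with hk
    set I : Ideal A := Ideal.span ((fun l : Fin n => u (l, 1)) '' {l | l < k}) with hI
    have hfin := Ideal.finite_minimalPrimes_of_isNoetherianRing A I
    set F : Finset (Ideal A) := hfin.toFinset.filter fun Q => ¬ ∀ l, u (l, 1) ∈ Q with hF
    have hFm : ∀ Q, Q ∈ F ↔ Q ∈ I.minimalPrimes ∧ ¬ ∀ l, u (l, 1) ∈ Q := by simp [hF]
    obtain ⟨z, hz, hzF⟩ := exists_add_notMem F (fun Q hQ => ((hFm Q).1 hQ).1.1.1)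
      (fun Q hQ Q' hQ' hle => le_antisymm hle
        (((hFm Q').1 hQ').1.2 ((hFm Q).1 hQ).1.1 hle)) (u (k, 1))
      (Ideal.span (Set.range fun l : Fin n => if k < l then u (l, 1) else 0)) (by
        intro Q hQ hkQ hle
        obtain ⟨hQ1, hQ2⟩ := (hFm Q).1 hQ
        refine hQ2 fun l => ?_
        rcases lt_trichotomy l k with h | rfl | h
        · exact hQ1.1.2 (Ideal.subset_span ⟨l, h, rfl⟩)
        · exact hkQ
        · exact hle (Ideal.subset_span ⟨l, by simp [h]⟩))
    obtain ⟨c, hc⟩ := Ideal.mem_span_range_iff_exists_fun.1 hz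
    obtain ⟨u', y, h1, h2, h3, h4, h5⟩ := exists_rel_transvection (T := .orthogonal) u
      (fun j => if j.2 = 0 ∧ k < j.1 then -c j.1 else 0) (k, 0)
    -- The coefficients are supported on positions `(l, 0)`, a totally isotropic set, so no
    -- quadratic correction arises.
    have hy : y = 0 := h5 fun j => by
      obtain ⟨l, e⟩ := j
      fin_cases e <;> simp [swap, Fin.rev]
    have h6 : ∀ l, l ≠ k → u' (l, 1) = u (l, 1) := fun l hl => by
      rw [h3 (l, 1) hl]
      simp
    have h7 : u' (k, 1) = u (k, 1) + z := by
      rw [← swap_mk_zero, h4, hy, ← hc, Finset.sum_filter, Fintype.sum_prod_type]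
      simp only [Fin.sum_univ_two, swap_mk_zero, swap_mk_one, sgn]
      rw [zero_mul, add_zero, sub_eq_add_neg, ← Finset.sum_neg_distrib]
      congr 1
      refine Finset.sum_congr rfl fun l _ => ?_
      by_cases hl : k < l
      · simp [hl, hl.ne']
      · simp [hl]
    have hzQ : ∀ Q : Ideal A, (∀ l, l ≠ k → u (l, 1) ∈ Q) → z ∈ Q := fun Q hQ => by
      rw [← hc]
      refine Q.sum_mem fun l _ => Q.mul_mem_left _ ?_
      split_ifs with hl
      · exact hQ l hl.ne'
      · exact Q.zero_mem
    have hall : ∀ Q : Ideal A, (∀ l, u (l, 1) ∈ Q) → ∀ l, u' (l, 1) ∈ Q := fun Q hQ l => by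
      by_cases hl : l = k
      · rw [hl, h7]
        exact Q.add_mem (hQ k) (hzQ Q fun l _ => hQ l)
      · rw [h6 l hl]
        exact hQ l
    refine ⟨u', hu.trans h1, fun j hj P hP hlt hnot => ?_⟩
    have hnot' : ¬ ∀ l, u (l, 1) ∈ P := fun h => hnot (hall P h)
    rcases Nat.lt_or_eq_of_le hj with hj | rfl
    · refine hgen j (by omega) P hP (fun l hl => ?_) hnot'
      rw [← h6 l (by rintro rfl; simp [hk] at hl; omega)]
      exact hlt l hl
    · obtain ⟨Q, hQ, hQP⟩ := Ideal.exists_minimalPrimes_le (I := I) (J := P) (by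
        rw [hI, Ideal.span_le]
        rintro _ ⟨l, hl, rfl⟩
        have hl' : l < k := hl
        have := hlt l (by have : (l : ℕ) < m := hl'; omega)
        rwa [h6 l hl'.ne] at this)
      have hQp : Q.IsPrime := hQ.1.1
      have hQnot : ¬ ∀ l, u (l, 1) ∈ Q := fun h => hnot' fun l => hQP (h l)
      have hQF := hzF Q ((hFm Q).2 ⟨hQ, hQnot⟩)
      rw [← h7] at hQF
      have hne : Q ≠ P := by
        rintro rfl
        exact hQF (hlt k (by simp [hk]))
      have hht := hgen m le_rfl Q hQp (fun l hl => hQ.1.2 (Ideal.subset_span ⟨l, hl, rfl⟩)) hQnot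
      have := Ideal.height_add_one_le_of_lt_of_isPrime (lt_of_le_of_ne hQP hne)
      push_cast
      exact (add_le_add_left hht 1).trans this

/-- Taken at `m = 0`, this says that the entries `(l, 0)` alone control all entries at primes
disjoint from `S`. The entries `v (m, 1)` are traded one at a time: primes containing the first `m`
of them, but not `v (m, 1)`, have height at least `m`, and the `n - 1 - m` entries `(l, 0)` with `l
> m` suffice for the remaining dimensions because `d + 2 ≤ n`. -/
lemma exists_rel_forall_prime (S : Submonoid A) (d : ℕ) (hn : d + 2 ≤ n)
    (hd : ∀ P : Ideal A, P.IsPrime → Disjoint (P : Set A) S → P.height ≤ d)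
    (v : Pos n → A) (hgen : ∀ k ≤ n, GenericUpTo k v) (r m : ℕ) (hrm : r + m = n) :
    ∃ v', Rel .orthogonal v v' ∧ (∀ l, v' (l, 1) = v (l, 1)) ∧
      ∀ P : Ideal A, P.IsPrime → Disjoint (P : Set A) S → (∀ l : Fin n, l < m → v (l, 1) ∈ P) →
        (∀ l : Fin n, m ≤ l → v' (l, 0) ∈ P) → ∀ l, v (l, 1) ∈ P := by
  classical
  induction r generalizing m with
  | zero => exact ⟨v, Rel.refl v, fun _ => rfl, fun P _ _ h _ l => h l (by omega)⟩
  | succ r ih =>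
    obtain ⟨u, h1, h2, h3⟩ := ih (m + 1) (by omega)
    set k : Fin n := ⟨m, by omega⟩ with hk
    obtain ⟨x, hx⟩ := exists_forall_prime_mem S d hd (fun l : Fin n => u (l, 0)) (v (k, 1))
      (Finset.Ioi k) (Ideal.span ((fun l : Fin n => v (l, 1)) '' {l | l < k})) m
      (fun P hP _ hle hkP => hgen m (by omega) P hP
        (fun l hl => hle (Ideal.subset_span ⟨l, hl, rfl⟩)) fun h => hkP (h k))
      (by rw [Fin.card_Ioi]; simp [hk]; omega)
    obtain ⟨u', y, k1, k2, k3, -⟩ := exists_rel_transvection (T := .orthogonal) u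
      (fun j => if j.2 = 0 ∧ k < j.1 then x j.1 else 0) (k, 1)
    refine ⟨u', h1.trans k1, fun l => ?_, fun P hP hPS hlt hge => ?_⟩
    · by_cases hl : l = k
      · rw [hl, k2, h2]
      · rw [k3 (l, 1) hl]
        simp [h2]
    · have h4 : ∀ l, k < l → u (l, 0) + x l * v (k, 1) ∈ P := fun l hl => by
        have := hge l (le_of_lt hl)
        rw [k3 (l, 0) hl.ne'] at this
        simpa [hl, h2] using this
      have h5 : v (k, 1) ∈ P := by
        refine hx P hP hPS ?_ fun l hl => h4 l (Finset.mem_Ioi.1 hl)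
        rw [Ideal.span_le]
        rintro _ ⟨l, hl, rfl⟩
        exact hlt l hl
      refine h3 P hP hPS (fun l hl => ?_) fun l hl => ?_
      · rcases Nat.lt_or_eq_of_le (Nat.lt_succ_iff.1 hl) with h | h
        · exact hlt l h
        · rwa [show l = k from Fin.ext h]
      · have := P.sub_mem (h4 l (show m < l by omega)) (P.mul_mem_left (x l) h5)
        simpa using this

/-- There is no long generator, so the coordinate must be changed using only entries of a totally
isotropic set. First all the information is concentrated in the `n` entries `(l, 0)`, then in those
with `l ≠ k`. -/
lemma exists_rel_add_mul_orthogonal [IsNoetherianRing A] (S : Submonoid A) (d : ℕ)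
    (hn : d + 2 ≤ n)
    (hd : ∀ P : Ideal A, P.IsPrime → Disjoint (P : Set A) S → P.height ≤ d)
    {v w : Pos n → A} (hw : v ⬝ᵥ w = 1) (k : Fin n) :
    ∃ v', Rel .orthogonal v v' ∧ ∃ s ∈ S, ∀ t, ∃ v'', Rel .orthogonal v' v'' ∧
      v'' (k, 0) = v' (k, 0) + t * s := by
  classical
  obtain ⟨u₁, h1, hgen⟩ := exists_rel_genericUpTo v n le_rfl
  obtain ⟨u, h2, h3, h4⟩ := exists_rel_forall_prime S d hn hd u₁ hgen n 0 rfl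
  obtain ⟨w', hw'⟩ := exists_dotProduct_of_rel (h1.trans h2) hw
  have hodd : ∀ P : Ideal A, P.IsPrime → Disjoint (P : Set A) S → ¬ ∀ l, u (l, 0) ∈ P := by
    intro P hP hPS h
    refine forall_prime_not_of_dotProduct hw' P hP ?_
    rintro ⟨l, e⟩
    fin_cases e
    · exact h l
    · change u (l, 1) ∈ P
      rw [h3]
      exact h4 P hP hPS (fun l hl => by omega) (fun l _ => h l) l
  -- Removing `k` leaves `n - 1 ≥ d + 1` entries, exactly what is needed.
  obtain ⟨x, hx⟩ := exists_forall_prime_mem S d hd (fun l : Fin n => u (l, 0)) (u (k, 0))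
    (Finset.univ.erase k) ⊥ 0 (by simp)
    (by rw [Finset.card_erase_of_mem (Finset.mem_univ k)]; simp; omega)
  obtain ⟨u', y, k1, k2, k3, -⟩ := exists_rel_transvection (T := .orthogonal) u
    (fun j => if j.2 = 0 then x j.1 else 0) (k, 0)
  have k4 : ∀ l, l ≠ k → u' (l, 0) = u (l, 0) + x l * u (k, 0) := fun l hl => by
    rw [k3 (l, 0) hl]
    simp
  obtain ⟨s, hsS, hs⟩ := exists_mem_span_of_forall_prime S
    (Ideal.span (Set.range fun l => if l = k then 0 else u' (l, 0))) (fun P hP hPS hle => by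
      have h5 : ∀ l, l ≠ k → u (l, 0) + x l * u (k, 0) ∈ P := fun l hl =>
        hle (Ideal.subset_span ⟨l, by simp [hl, k4]⟩)
      have h6 := hx P hP hPS bot_le (fun l hl => h5 l (Finset.ne_of_mem_erase hl))
      refine hodd P hP hPS fun l => ?_
      by_cases hl : l = k
      · rwa [hl]
      · simpa using P.sub_mem (h5 l hl) (P.mul_mem_left (x l) h6))
  obtain ⟨c, hc⟩ := Ideal.mem_span_range_iff_exists_fun.1 hs
  refine ⟨u', (h1.trans h2).trans k1, s, hsS, fun t => ?_⟩
  obtain ⟨u'', y, l1, -, l2, l3⟩ := exists_rel_add_sum (T := .orthogonal) u'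
    (fun j => if j.2 = 0 then t * c j.1 else 0) (k, 0)
  refine ⟨u'', l1, ?_⟩
  rw [l2, l3 (fun j => by obtain ⟨l, e⟩ := j; fin_cases e <;> simp [swap, Fin.rev]), ← hc,
    zero_mul, add_zero, Finset.sum_filter, Fintype.sum_prod_type, Finset.mul_sum]
  congr 1
  refine Finset.sum_congr rfl fun l _ => ?_
  by_cases hl : l = k
  · simp [hl]
  · simp [hl, mul_assoc]

end Stability

/-! ### Monoid rings -/

section MonoidRings

variable {T : ClassicalType} {n : ℕ} {R : Type*} [CommRing R]

lemma mapDomainRingHom_injective {K H : Type*} [AddCommMonoid K] [AddCommMonoid H] (j : K →+ H)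
    (hj : Function.Injective j) :
    Function.Injective (AddMonoidAlgebra.mapDomainRingHom R j) :=
  AddMonoidAlgebra.mapDomain_injective hj

lemma mem_range_mapDomainRingHom {K H : Type*} [AddCommMonoid K] [AddCommMonoid H] (j : K →+ H)
    (hj : Function.Injective j) {x : AddMonoidAlgebra R H}
    (hx : ∀ h, x.coeff h ≠ 0 → h ∈ Set.range j) :
    x ∈ Set.range (AddMonoidAlgebra.mapDomainRingHom R j) :=
  ⟨AddMonoidAlgebra.comapDomain j hj x, AddMonoidAlgebra.mapDomain_comapDomain
    (fun h hh => hx h (Finsupp.mem_support_iff.1 hh)) hj⟩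

/-- Two rows and the witnesses of their unimodularity have finite support, so the problem descends
to any submonoid containing that support. -/
lemma trivialOrbitSpace_of_forall_finset {H : Type*} [AddCommMonoid H]
    (h : ∀ X : Finset H, ∃ (K : Type*) (_ : AddCommMonoid K) (j : K →+ H), Function.Injective j ∧
      (∀ x ∈ X, x ∈ Set.range j) ∧ TrivialOrbitSpace T n (AddMonoidAlgebra R K)) :
    TrivialOrbitSpace T n (AddMonoidAlgebra R H) := by
  classical
  intro u hu v hv
  obtain ⟨u', hu'⟩ := hu.1
  obtain ⟨v', hv'⟩ := hv.1
  obtain ⟨K, _, j, hj, hX, hK⟩ := h (Finset.univ.biUnion fun i =>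
    (u i).coeff.support ∪ (v i).coeff.support ∪ ((u' i).coeff.support ∪ (v' i).coeff.support))
  set f := AddMonoidAlgebra.mapDomainRingHom R j
  have hf : Function.Injective f := mapDomainRingHom_injective j hj
  have key : ∀ w : Pos n → AddMonoidAlgebra R H, (∀ i, (w i).coeff.support ⊆
      (u i).coeff.support ∪ (v i).coeff.support ∪
        ((u' i).coeff.support ∪ (v' i).coeff.support)) → ∃ w', f ∘ w' = w := by
    intro w hw
    have : ∀ i, w i ∈ Set.range f := fun i => mem_range_mapDomainRingHom j hj fun h hh =>
      hX h (Finset.mem_biUnion.2 ⟨i, Finset.mem_univ i, hw i (Finsupp.mem_support_iff.2 hh)⟩)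
    choose w' hw' using this
    exact ⟨w', funext hw'⟩
  have key2 : ∀ w w' : Pos n → AddMonoidAlgebra R K, (f ∘ w) ⬝ᵥ (f ∘ w') = 1 → w ⬝ᵥ w' = 1 :=
    fun w w' h => hf (by rw [RingHom.map_dotProduct, h, map_one])
  obtain ⟨a, rfl⟩ := key u fun i => by intro x hx; simp only [Finset.mem_union]; tauto
  obtain ⟨b, rfl⟩ := key v fun i => by intro x hx; simp only [Finset.mem_union]; tauto
  obtain ⟨a', rfl⟩ := key u' fun i => by intro x hx; simp only [Finset.mem_union]; tauto
  obtain ⟨b', rfl⟩ := key v' fun i => by intro x hx; simp only [Finset.mem_union]; tauto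
  exact Rel.map f (hK a (mem_Um_of_map f hf hu ⟨a', key2 _ _ hu'⟩) b
    (mem_Um_of_map f hf hv ⟨b', key2 _ _ hv'⟩))

lemma trivialOrbitSpace_of_addEquiv {H K : Type*} [AddCommMonoid H] [AddCommMonoid K] (e : K ≃+ H)
    (h : TrivialOrbitSpace T n (AddMonoidAlgebra R K)) :
    TrivialOrbitSpace T n (AddMonoidAlgebra R H) :=
  trivialOrbitSpace_of_forall_finset fun _ =>
    ⟨K, _, e.toAddMonoidHom, e.injective, fun x _ => e.surjective x, h⟩

end MonoidRings

/-! ### Interior elements -/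

section Interior

open scoped NNReal

/-- A finite generating set gives a surjective, hence open, linear map from a coordinate space. It
suffices that `m` plus a small combination of generators stays in the cone, and each generator is
dominated by a multiple of `m`. -/
lemma toReal_mem_coneInterior {N : Type*} [AddCommMonoid N] (hfg : AddMonoid.FG N) (m : N)
    (hm : ∀ y : N, ∃ (k : ℕ) (z : N), k • m = y + z) : toReal m ∈ coneInterior N := by
  classical
  obtain ⟨s, hs⟩ := AddMonoid.fg_def.1 hfg
  choose k z hkz using hm
  have hsmul : ∀ (c : ℕ) (x : N), toReal (c • x) = (c : ℝ) • toReal x := fun c x => by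
    rw [Nat.cast_smul_eq_nsmul]
    induction c with
    | zero => simp [toReal]
    | succ c ih => rw [succ_nsmul, succ_nsmul, toReal_add, ih]
  let _ : TopologicalSpace (RealSpan N) := moduleTopology ℝ (RealSpan N)
  have _ : IsModuleTopology ℝ (RealSpan N) := ⟨rfl⟩
  have _ : ContinuousAdd (RealSpan N) := ModuleTopology.continuousAdd ℝ (RealSpan N)
  let Λ : (s → ℝ) →ₗ[ℝ] RealSpan N := Fintype.linearCombination ℝ fun y : s => toReal (y : N)
  have hspan : ∀ x : N, toReal x ∈ LinearMap.range Λ := by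
    intro x
    have hx : x ∈ AddSubmonoid.closure (s : Set N) := hs ▸ AddSubmonoid.mem_top x
    induction hx using AddSubmonoid.closure_induction with
    | mem y hy => exact ⟨Pi.single ⟨y, hy⟩ 1, by simp [Λ]⟩
    | zero =>
      have : toReal (0 : N) = 0 := by simp [toReal]
      rw [this]
      exact zero_mem _
    | add x y _ _ hx hy => rw [toReal_add]; exact add_mem hx hy
  have hsurj : Function.Surjective Λ := by
    rw [← LinearMap.range_eq_top, eq_top_iff]
    rintro x -
    induction x using TensorProduct.induction_on with
    | zero => exact zero_mem _
    | add x y hx hy => exact add_mem hx hy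
    | tmul a g =>
      have : ∃ x y : N, g = toGp N x - toGp N y := by
        obtain ⟨p, hp⟩ := (AddLocalization.addMonoidOf (⊤ : AddSubmonoid N)).surj g
        exact ⟨p.1, p.2, eq_sub_of_add_eq hp⟩
      obtain ⟨x, y, rfl⟩ := this
      have h1 : a ⊗ₜ[ℤ] (toGp N x - toGp N y) = a • (toReal x - toReal y) := by
        simp [toReal, TensorProduct.tmul_sub, smul_sub, TensorProduct.smul_tmul']
      rw [h1]
      exact Submodule.smul_mem _ _ (sub_mem (hspan x) (hspan y))
  have hopen : IsOpenMap Λ := (IsModuleTopology.isOpenQuotientMap_of_surjective hsurj).isOpenMap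
  change toReal m ∈ interior (cone N : Set (RealSpan N))
  rw [mem_interior]
  -- Divide `m` into `card s + 1` equal shares, one for each generator and a spare one. The share of
  -- `y` equals `δ_y m + δ_y (y + z_y)`, so it absorbs any coefficient of `y` above `-δ_y`.
  set δ : s → ℝ := fun y => 1 / ((s.card + 1 : ℝ) * (k y + 1)) with hδ
  have hδpos : ∀ y, 0 < δ y := fun y => by positivity
  set U : Set (s → ℝ) := Set.pi Set.univ fun y => Set.Ioo (-δ y) (δ y) with hU
  have hUo : IsOpen U := isOpen_set_pi Set.finite_univ fun y _ => isOpen_Ioo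
  have hcone : ∀ (c : ℝ) (x : N), 0 ≤ c → c • toReal x ∈ cone N := fun c x hc =>
    (cone N).smul_mem hc (toReal_mem_cone x)
  refine ⟨(fun x => x + -toReal m) ⁻¹' (Λ '' U), ?_, (hopen U hUo).preimage (by fun_prop),
    ⟨0, fun y _ => ⟨by simp [hδpos], by simp [hδpos]⟩, by simp⟩⟩
  rintro x ⟨ε, hε, hx⟩
  have hx' : x = (1 / (s.card + 1 : ℝ)) • toReal m + ∑ y : s,
      ((1 / (s.card + 1 : ℝ)) • toReal m + ε y • toReal (y : N)) := by
    rw [Finset.sum_add_distrib]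
    have h1 : x = toReal m + ∑ y : s, ε y • toReal (y : N) := by
      have : Λ ε = ∑ y : s, ε y • toReal (y : N) := by
        simp [Λ, Fintype.linearCombination_apply]
      change Λ ε = x + -toReal m at hx
      rw [← this, hx, add_comm x, add_neg_cancel_left]
    rw [h1, ← add_assoc]
    congr 1
    rw [Finset.sum_const, Finset.card_univ, Fintype.card_coe, ← Nat.cast_smul_eq_nsmul ℝ, smul_smul,
      ← add_smul]
    have : (1 / (s.card + 1 : ℝ)) + s.card * (1 / (s.card + 1 : ℝ)) = 1 := by
      field_simp
      ring
    rw [this, one_smul]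
  rw [hx']
  refine (cone N).add_mem (hcone _ _ (by positivity)) ((cone N).sum_mem fun y _ => ?_)
  have h2 : (1 / (s.card + 1 : ℝ)) • toReal m + ε y • toReal (y : N) =
      δ y • toReal m + δ y • toReal (z y) + (δ y + ε y) • toReal (y : N) := by
    have h3 : ((k y : ℕ) : ℝ) • toReal m = toReal (y : N) + toReal (z y) := by
      rw [← hsmul, hkz, toReal_add]
    have h4 : toReal (z y) = ((k y : ℕ) : ℝ) • toReal m - toReal (y : N) := by
      rw [h3]; abel
    have h5 : 1 / (s.card + 1 : ℝ) = δ y + δ y * k y := by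
      have key : ∀ a b : ℝ, 0 < a → 0 < b + 1 →
          1 / a = 1 / (a * (b + 1)) + 1 / (a * (b + 1)) * b := by
        intro a b ha hb
        field_simp
        ring
      exact key _ _ (Nat.cast_add_one_pos _) (Nat.cast_add_one_pos _)
    rw [h4, h5]
    module
  rw [h2]
  have h6 := hε y (Set.mem_univ y)
  exact (cone N).add_mem ((cone N).add_mem (hcone _ _ (hδpos y).le) (hcone _ _ (hδpos y).le))
    (hcone _ _ (by linarith [h6.1]))

end Interior

/-! ### Open submonoids of a lattice -/

section OpenSubmonoids

variable {r : ℕ}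

/-- The elements of `L` with a positive multiple in the submonoid generated by `Y`. -/
def saturation {Γ : Type*} [AddCommGroup Γ] (L : AddSubgroup Γ) (Y : Set Γ) : AddSubmonoid Γ where
  carrier := {z | z ∈ L ∧ ∃ c : ℕ, 0 < c ∧ c • z ∈ AddSubmonoid.closure Y}
  zero_mem' := ⟨zero_mem _, 1, one_pos, by simp⟩
  add_mem' := by
    rintro x y ⟨hx, c, hc, hcx⟩ ⟨hy, c', hc', hcy⟩
    refine ⟨add_mem hx hy, c * c', Nat.mul_pos hc hc', ?_⟩
    rw [smul_add, mul_comm c, mul_smul, mul_comm c', mul_smul]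
    exact add_mem (nsmul_mem hcx _) (nsmul_mem hcy _)

/-- This is Gordan's lemma: modulo sums of elements of `Y`, every element of the saturation lies in
a bounded box, which contains finitely many lattice points. -/
lemma saturation_fg (L : AddSubgroup (Fin r → ℤ)) (Y : Finset (Fin r → ℤ))
    (hY : ∀ y ∈ Y, y ∈ L) : (saturation L (Y : Set (Fin r → ℤ))).FG := by
  classical
  set N := saturation L (Y : Set (Fin r → ℤ)) with hN
  set β : Fin r → ℤ := ∑ y ∈ Y, fun i => |y i| with hβ
  have hYN : ∀ y ∈ Y, y ∈ N := fun y hy =>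
    ⟨hY y hy, 1, one_pos, by simpa using AddSubmonoid.subset_closure hy⟩
  rw [AddSubmonoid.fg_iff]
  refine ⟨Y ∪ (Set.Icc (-β) β ∩ N), ?_, Y.finite_toSet.union ((Set.finite_Icc _ _).inter_of_left _)⟩
  refine le_antisymm ?_ ?_
  · rw [AddSubmonoid.closure_le]
    rintro x (hx | hx)
    · exact hYN x hx
    · exact hx.2
  · intro z hz
    obtain ⟨hzL, c, hc, hcz⟩ := hz
    obtain ⟨f, -, hf⟩ := AddSubmonoid.mem_closure_finset.1 hcz
    -- The integral parts of the rational coefficients `f y / c`; the remainders are smaller than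
    -- one.
    set u : Fin r → ℤ := ∑ y ∈ Y, (f y / c) • y with hu
    have huL : u ∈ L := sum_mem fun y hy => nsmul_mem (hY y hy) _
    have hw : c • (z - u) = ∑ y ∈ Y, (f y % c) • y := by
      rw [smul_sub, ← hf, hu, Finset.smul_sum, ← Finset.sum_sub_distrib]
      refine Finset.sum_congr rfl fun y _ => ?_
      rw [smul_smul, sub_eq_iff_eq_add, ← add_smul, Nat.mod_add_div]
    have hwN : z - u ∈ N := ⟨sub_mem hzL huL, c, hc, by
      rw [hw]
      exact sum_mem fun y hy => nsmul_mem (AddSubmonoid.subset_closure hy) _⟩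
    have hbound : ∀ i, |(z - u) i| ≤ β i := by
      intro i
      have h1 : (c : ℤ) * |(z - u) i| ≤ c * β i := by
        have h2 := congrFun hw i
        rw [Finset.sum_apply, Pi.smul_apply, nsmul_eq_mul] at h2
        rw [← Nat.abs_cast c, ← abs_mul, h2, hβ, Finset.sum_apply, Nat.abs_cast, Finset.mul_sum]
        refine (Finset.abs_sum_le_sum_abs _ _).trans (Finset.sum_le_sum fun y _ => ?_)
        rw [Pi.smul_apply, nsmul_eq_mul, abs_mul, Nat.abs_cast]
        have : f y % c ≤ c := (Nat.mod_lt _ hc).le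
        gcongr
      exact le_of_mul_le_mul_left h1 (by exact_mod_cast hc)
    have hzu : z = (z - u) + u := by abel
    rw [hzu]
    refine AddSubmonoid.add_mem _
      (AddSubmonoid.subset_closure (Set.mem_union_right _ ⟨⟨fun i => ?_, fun i => ?_⟩, hwN⟩))
      (sum_mem fun y hy => nsmul_mem (AddSubmonoid.subset_closure (Set.mem_union_left _ hy)) _)
    · exact (abs_le.1 (hbound i)).1
    · exact (abs_le.1 (hbound i)).2

/-- Positive submonoids `H` of a group `L` which are saturated in `L` and all of whose nonzero
elements are interior. -/
structure IsOpenSubmonoid {Γ : Type*} [AddCommGroup Γ] (L : AddSubgroup Γ) (H : AddSubmonoid Γ) :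
    Prop where
  le : ∀ x ∈ H, x ∈ L
  absorb : ∀ x ∈ H, x ≠ 0 → ∀ y ∈ L, ∃ k : ℕ, k • x + y ∈ H
  pos : ∀ x ∈ H, ∀ y ∈ H, x + y = 0 → x = 0
  sat : ∀ z ∈ L, ∀ c : ℕ, 0 < c → c • z ∈ H → z ∈ H

lemma exists_finset_closure_eq (L : AddSubgroup (Fin r → ℤ)) :
    ∃ B : Finset (Fin r → ℤ), AddSubgroup.closure (B : Set (Fin r → ℤ)) = L := by
  have : (AddSubgroup.toIntSubmodule L).FG := IsNoetherian.noetherian _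
  rw [Submodule.fg_iff_addSubgroup_fg] at this
  exact this

lemma isNormal_of_saturated {Γ : Type*} [AddCommGroup Γ] {L : AddSubgroup Γ} {N : AddSubmonoid Γ}
    (hNL : ∀ x ∈ N, x ∈ L) (hsat : ∀ z ∈ L, ∀ c : ℕ, 0 < c → c • z ∈ N → z ∈ N) : IsNormal N := by
  rintro x c hc ⟨a, ha⟩
  obtain ⟨p, hp⟩ := (AddLocalization.addMonoidOf (⊤ : AddSubmonoid N)).surj x
  have hx : x = toGp N p.1 - toGp N p.2 := eq_sub_of_add_eq hp
  have h1 : toGp N (a + c • (p.2 : N)) = toGp N (c • p.1) := by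
    rw [map_add, ha, map_nsmul, map_nsmul, hx, ← smul_add, sub_add_cancel]
  have h2 := Algebra.GrothendieckAddGroup.of_injective h1
  have h3 : c • (((p.1 : N) : Γ) - ((p.2 : N) : Γ)) ∈ N := by
    have h4 : (a : Γ) + c • ((p.2 : N) : Γ) = c • ((p.1 : N) : Γ) := congrArg Subtype.val h2
    rw [smul_sub, ← h4, add_sub_cancel_right]
    exact a.2
  have h5 := hsat _ (sub_mem (hNL _ p.1.2) (hNL _ (p.2 : N).2)) c hc h3
  refine ⟨⟨_, h5⟩, ?_⟩
  rw [hx, eq_sub_iff_add_eq, ← map_add]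
  congr 1
  ext1
  simp

variable {T : ClassicalType} {n : ℕ} {R : Type*} [CommRing R]

/-- A finite subset of `H` lies in `N_*` for some affine, positive, normal `N ⊆ H`. Adding suitable
elements `k x + b` and `k x - b`, with `b` running through generators of `L`, makes each nonzero `x`
interior; saturation keeps `N` inside `H` and makes it normal. -/
theorem trivialOrbitSpace_of_isOpenSubmonoid
    (hN : ∀ (N : Type) [AddCommMonoid N], IsAffine N → IsPositive N → IsNormal N →
      TrivialOrbitSpace T n (AddMonoidAlgebra R (interiorMonoid N)))
    {L : AddSubgroup (Fin r → ℤ)} {H : AddSubmonoid (Fin r → ℤ)} (hH : IsOpenSubmonoid L H) :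
    TrivialOrbitSpace T n (AddMonoidAlgebra R H) := by
  classical
  refine trivialOrbitSpace_of_forall_finset fun X => ?_
  obtain ⟨B, hB⟩ := exists_finset_closure_eq L
  have hBL : ∀ b ∈ B, b ∈ L := fun b hb => hB ▸ AddSubgroup.subset_closure hb
  have hk : ∀ (x : H) (b : Fin r → ℤ), ∃ k : ℕ, (x : Fin r → ℤ) ≠ 0 → b ∈ L →
      k • (x : Fin r → ℤ) + b ∈ H := by
    intro x b
    by_cases h : (x : Fin r → ℤ) ≠ 0 ∧ b ∈ L
    · obtain ⟨k, hk⟩ := hH.absorb x x.2 h.1 b h.2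
      exact ⟨k, fun _ _ => hk⟩
    · exact ⟨0, fun h1 h2 => absurd ⟨h1, h2⟩ h⟩
  choose k hk using hk
  set X₀ : Finset H := X.filter fun x => (x : Fin r → ℤ) ≠ 0 with hX₀
  set B' : Finset (Fin r → ℤ) := B ∪ B.image (fun b => -b) with hB'
  have hB'L : ∀ b ∈ B', b ∈ L := by
    intro b hb
    rcases Finset.mem_union.1 hb with hb | hb
    · exact hBL b hb
    · obtain ⟨b', hb', rfl⟩ := Finset.mem_image.1 hb
      exact neg_mem (hBL b' hb')
  set Y : Finset (Fin r → ℤ) := Finset.image (fun x : H => (x : Fin r → ℤ)) X₀ ∪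
    Finset.image (fun q : H × (Fin r → ℤ) => k q.1 q.2 • (q.1 : Fin r → ℤ) + q.2) (X₀ ×ˢ B') with hY
  have hYH : ∀ y ∈ Y, y ∈ H := by
    intro y hy
    rcases Finset.mem_union.1 hy with hy | hy
    · obtain ⟨x, -, rfl⟩ := Finset.mem_image.1 hy
      exact x.2
    · obtain ⟨⟨x, b⟩, hq, rfl⟩ := Finset.mem_image.1 hy
      obtain ⟨hx, hb⟩ := Finset.mem_product.1 hq
      exact hk x b (Finset.mem_filter.1 hx).2 (hB'L b hb)
  set N := saturation L (Y : Set (Fin r → ℤ)) with hNdef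
  have hclY : AddSubmonoid.closure (Y : Set (Fin r → ℤ)) ≤ H := (AddSubmonoid.closure_le).2 hYH
  have hNH : N ≤ H := fun z hz => by
    obtain ⟨hzL, c, hc, hcz⟩ := hz
    exact hH.sat z hzL c hc (hclY hcz)
  have hNL : ∀ x ∈ N, x ∈ L := fun x hx => hx.1
  have hclN : AddSubmonoid.closure (Y : Set (Fin r → ℤ)) ≤ N := fun z hz =>
    ⟨hH.le z (hclY hz), 1, one_pos, by simpa using hz⟩
  -- Both signs are carried along so that the induction passes to negatives.
  have horder : ∀ x ∈ X₀, ∀ y ∈ L,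
      (∃ m : ℕ, m • (x : Fin r → ℤ) + y ∈ AddSubmonoid.closure (Y : Set (Fin r → ℤ))) ∧
      ∃ m : ℕ, m • (x : Fin r → ℤ) + -y ∈ AddSubmonoid.closure (Y : Set (Fin r → ℤ)) := by
    intro x hx y hy
    rw [← hB] at hy
    have hmem : ∀ b ∈ B', k x b • (x : Fin r → ℤ) + b ∈
        AddSubmonoid.closure (Y : Set (Fin r → ℤ)) := fun b hb =>
      AddSubmonoid.subset_closure (Finset.mem_coe.2 (Finset.mem_union_right _
        (Finset.mem_image.2 ⟨(x, b), Finset.mem_product.2 ⟨hx, hb⟩, rfl⟩)))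
    induction hy using AddSubgroup.closure_induction with
    | mem b hb =>
      exact ⟨⟨_, hmem b (Finset.mem_union_left _ hb)⟩, ⟨_, hmem (-b) (Finset.mem_union_right _
        (Finset.mem_image.2 ⟨b, hb, rfl⟩))⟩⟩
    | zero => exact ⟨⟨0, by simp⟩, ⟨0, by simp⟩⟩
    | add y z _ _ hy hz =>
      obtain ⟨⟨m₁, h₁⟩, ⟨m₂, h₂⟩⟩ := hy
      obtain ⟨⟨l₁, h₃⟩, ⟨l₂, h₄⟩⟩ := hz
      refine ⟨⟨m₁ + l₁, ?_⟩, ⟨m₂ + l₂, ?_⟩⟩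
      · convert add_mem h₁ h₃ using 1
        rw [add_smul]; abel
      · convert add_mem h₂ h₄ using 1
        rw [add_smul]; abel
    | neg y _ hy => exact ⟨hy.2, by simpa using hy.1⟩
  have hfg : AddMonoid.FG N := (AddMonoid.fg_iff_addSubmonoid_fg N).2
    (saturation_fg L Y fun y hy => hH.le y (hYH y hy))
  refine ⟨interiorMonoid N, inferInstance,
    (AddSubmonoid.inclusion hNH).comp (interiorMonoid N).subtype, ?_, ?_, ?_⟩
  · exact (AddSubmonoid.inclusion_injective hNH).comp Subtype.val_injective
  · intro x hx
    by_cases hx0 : (x : Fin r → ℤ) = 0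
    · exact ⟨0, by rw [map_zero]; exact Subtype.ext hx0.symm⟩
    have hxX : x ∈ X₀ := Finset.mem_filter.2 ⟨hx, hx0⟩
    have hxN : (x : Fin r → ℤ) ∈ N := hclN (AddSubmonoid.subset_closure (Finset.mem_coe.2
      (Finset.mem_union_left _ (Finset.mem_image_of_mem _ hxX))))
    refine ⟨⟨⟨x, hxN⟩, Or.inl (toReal_mem_coneInterior hfg _ fun y => ?_)⟩, rfl⟩
    obtain ⟨m, hm⟩ := (horder x hxX y (hNL y y.2)).2
    refine ⟨m, ⟨_, hclN hm⟩, Subtype.ext ?_⟩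
    simp
  · refine hN N ⟨hfg, r, N.subtype, Subtype.val_injective⟩ ?_ ?_
    · rintro x ⟨u, rfl⟩
      have h1 : ((u : N) : Fin r → ℤ) + ((-u : AddUnits N) : N) = 0 := by
        exact congrArg Subtype.val u.val_neg
      exact Subtype.ext (hH.pos _ (hNH (u : N).2) _ (hNH ((-u : AddUnits N) : N).2) h1)
    · refine isNormal_of_saturated hNL fun z hz c hc hcz => ?_
      obtain ⟨-, c', hc', h⟩ := hcz
      exact ⟨hz, c' * c, Nat.mul_pos hc' hc, by rwa [mul_smul]⟩

end OpenSubmonoids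

/-! ### The filtration of a group ring defined by a linear form -/

section Filtration

variable {R : Type*} [CommRing R] {G : Type*} [AddCommGroup G] (φ : G →+ ℤ)

/-- The elements supported in the half space `φ ≥ K`. -/
def filt (R : Type*) [CommRing R] (φ : G →+ ℤ) (K : ℤ) : AddSubgroup (AddMonoidAlgebra R G) where
  carrier := {w | ∀ g, w.coeff g ≠ 0 → K ≤ φ g}
  zero_mem' := by simp
  add_mem' := by
    intro x y hx hy g hg
    by_cases h : x.coeff g = 0
    · exact hy g fun h' => hg (by simp [h, h'])
    · exact hx g h
  neg_mem' := by
    intro x hx g hg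
    exact hx g fun h => hg (by simp [h])

variable {φ}

lemma filt_mono {K K' : ℤ} (h : K ≤ K') {w : AddMonoidAlgebra R G} (hw : w ∈ filt R φ K') :
    w ∈ filt R φ K := fun g hg => h.trans (hw g hg)

lemma single_mem_filt (g : G) (a : R) {K : ℤ} (h : K ≤ φ g) :
    AddMonoidAlgebra.single g a ∈ filt R φ K := by
  classical
  intro g' hg'
  rw [AddMonoidAlgebra.coeff_single, Finsupp.single_apply] at hg'
  by_cases e : g = g'
  · rwa [← e]
  · simp [e] at hg'

lemma one_mem_filt : (1 : AddMonoidAlgebra R G) ∈ filt R φ 0 := by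
  rw [AddMonoidAlgebra.one_def]
  exact single_mem_filt 0 1 (by simp)

lemma mul_mem_filt {K K' : ℤ} {w w' : AddMonoidAlgebra R G} (hw : w ∈ filt R φ K)
    (hw' : w' ∈ filt R φ K') : w * w' ∈ filt R φ (K + K') := by
  classical
  intro g hg
  rw [AddMonoidAlgebra.coeff_mul] at hg
  by_contra hlt
  refine hg (Finset.sum_eq_zero fun a ha => Finset.sum_eq_zero fun b hb => if_neg ?_)
  rintro rfl
  have h1 := hw a (Finsupp.mem_support_iff.1 ha)
  have h2 := hw' b (Finsupp.mem_support_iff.1 hb)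
  rw [map_add] at hlt
  omega

lemma pow_mem_filt {w : AddMonoidAlgebra R G} (hw : w ∈ filt R φ 1) (N : ℕ) :
    w ^ N ∈ filt R φ N := by
  induction N with
  | zero => simpa using one_mem_filt
  | succ N ih =>
    rw [pow_succ]
    push_cast
    exact mul_mem_filt ih hw

lemma exists_mem_filt (φ : G →+ ℤ) (w : AddMonoidAlgebra R G) : ∃ K : ℕ, w ∈ filt R φ (-K) := by
  refine ⟨∑ g ∈ w.coeff.support, (φ g).natAbs, fun g hg => ?_⟩
  have := Finset.single_le_sum (f := fun g => (φ g).natAbs) (fun _ _ => Nat.zero_le _)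
    (Finsupp.mem_support_iff.2 hg)
  omega

/-- The lowest term of `f` with respect to `φ` is the monomial `g₀`, with coefficient one. -/
def IsLowest (φ : G →+ ℤ) (g₀ : G) (f : AddMonoidAlgebra R G) : Prop :=
  f - AddMonoidAlgebra.single g₀ 1 ∈ filt R φ (φ g₀ + 1)

lemma IsLowest.mem_filt {g₀ : G} {f : AddMonoidAlgebra R G} (h : IsLowest φ g₀ f) :
    f ∈ filt R φ (φ g₀) := by
  have := add_mem (filt_mono (by omega) h) (single_mem_filt (R := R) g₀ 1 (le_refl (φ g₀)))
  rwa [sub_add_cancel] at this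

/-- The monomial `g₀` is invertible. Subtracting `w g₀⁻¹ f` cancels the lowest layer of `w`, and
repetition reaches any degree: `f` acts as a unit in the completion. -/
lemma IsLowest.exists_add_mul_mem_filt {g₀ : G} {f : AddMonoidAlgebra R G}
    (h : IsLowest φ g₀ f) (w : AddMonoidAlgebra R G) (K : ℤ) : ∃ c, w + c * f ∈ filt R φ K := by
  have step : ∀ (m : ℤ) (w : AddMonoidAlgebra R G), w ∈ filt R φ m →
      ∃ c, w + c * f ∈ filt R φ (m + 1) := by
    intro m w hw
    refine ⟨-(w * AddMonoidAlgebra.single (-g₀) 1), ?_⟩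
    have h1 : w + -(w * AddMonoidAlgebra.single (-g₀) 1) * f =
        -(w * (AddMonoidAlgebra.single (-g₀) 1 * (f - AddMonoidAlgebra.single g₀ 1))) := by
      have : (AddMonoidAlgebra.single (-g₀) 1 * AddMonoidAlgebra.single g₀ 1 :
          AddMonoidAlgebra R G) = 1 := by
        rw [AddMonoidAlgebra.single_mul_single, neg_add_cancel, mul_one]; rfl
      linear_combination -w * this
    rw [h1]
    have h2 := mul_mem_filt hw (mul_mem_filt (single_mem_filt (R := R) (φ := φ) (-g₀) 1 le_rfl) h)
    refine neg_mem (filt_mono ?_ h2)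
    rw [map_neg]
    omega
  obtain ⟨m, hm⟩ := exists_mem_filt φ w
  have key : ∀ k : ℕ, ∃ c, w + c * f ∈ filt R φ (-m + k) := by
    intro k
    induction k with
    | zero => exact ⟨0, by simpa using hm⟩
    | succ k ih =>
      obtain ⟨c, hc⟩ := ih
      obtain ⟨c', hc'⟩ := step _ _ hc
      refine ⟨c + c', ?_⟩
      rw [add_mul, ← add_assoc]
      push_cast
      rwa [← add_assoc]
  obtain ⟨c, hc⟩ := key (m + K.toNat)
  exact ⟨c, filt_mono (by push_cast; have := Int.self_le_toNat K; omega) hc⟩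

/-- Multiplication by `f` shifts the filtration by exactly `φ g₀`, since the lowest monomial of `f`
is invertible. -/
lemma IsLowest.mem_filt_of_mul {g₀ : G} {f w : AddMonoidAlgebra R G}
    (h : IsLowest φ g₀ f) {K : ℤ} (hfw : f * w ∈ filt R φ (K + φ g₀)) : w ∈ filt R φ K := by
  obtain ⟨m, hm⟩ := exists_mem_filt φ w
  have key : ∀ k : ℕ, (-m + k : ℤ) ≤ K → w ∈ filt R φ (-m + k) := by
    intro k
    induction k with
    | zero => exact fun _ => by simpa using hm
    | succ k ih =>
      intro hk
      push_cast at hk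
      have hw := ih (by omega)
      have h1 : w = AddMonoidAlgebra.single (-g₀) 1 *
          (f * w - (f - AddMonoidAlgebra.single g₀ 1) * w) := by
        have : (AddMonoidAlgebra.single (-g₀) 1 * AddMonoidAlgebra.single g₀ 1 :
            AddMonoidAlgebra R G) = 1 := by
          rw [AddMonoidAlgebra.single_mul_single, neg_add_cancel, mul_one]; rfl
        linear_combination -w * this
      rw [h1]
      have h2 : f * w - (f - AddMonoidAlgebra.single g₀ 1) * w ∈ filt R φ (-m + (k + 1) + φ g₀) :=
        sub_mem (filt_mono (by omega) hfw) (filt_mono (by omega) (mul_mem_filt h hw))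
      refine filt_mono ?_ (mul_mem_filt (single_mem_filt (R := R) (φ := φ) (-g₀) 1 le_rfl) h2)
      rw [map_neg]
      push_cast
      omega
  by_cases hK : -(m : ℤ) ≤ K
  · refine filt_mono ?_ (key (K + m).toNat ?_) <;> omega
  · exact filt_mono (by omega) hm

lemma isLowest_iff {g₀ : G} {f : AddMonoidAlgebra R G} :
    IsLowest φ g₀ f ↔ f.coeff g₀ = 1 ∧ ∀ g, g ≠ g₀ → f.coeff g ≠ 0 → φ g₀ < φ g := by
  classical
  have hc : ∀ g, (f - AddMonoidAlgebra.single g₀ 1).coeff g =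
      f.coeff g - if g₀ = g then 1 else 0 := fun g => by
    rw [AddMonoidAlgebra.coeff_sub, Finsupp.sub_apply, AddMonoidAlgebra.coeff_single,
      Finsupp.single_apply]
  constructor
  · intro h
    constructor
    · by_contra h1
      have := h g₀ (by rw [hc, if_pos rfl]; exact sub_ne_zero.2 h1)
      omega
    · intro g hg hfg
      have := h g (by rw [hc, if_neg hg.symm, sub_zero]; exact hfg)
      omega
  · rintro ⟨h1, h2⟩ g hg
    rw [hc] at hg
    by_cases e : g₀ = g
    · rw [if_pos e, ← e, h1, sub_self] at hg
      exact absurd rfl hg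
    · rw [if_neg e, sub_zero] at hg
      exact h2 g (Ne.symm e) hg

end Filtration

/-! ### Multiplicative sets of elements with a lowest term -/

section LowestSystem

/-- There is a multiplicative set of elements of `R[G]` having a lowest term with respect to
some linear form, such that all primes disjoint from it have height at most `d`. -/
def HasLowestSystem (R : Type*) [CommRing R] (G : Type*) [AddCommGroup G] (d : ℕ) : Prop :=
  ∃ S : Submonoid (AddMonoidAlgebra R G),
    (∀ P : Ideal (AddMonoidAlgebra R G), P.IsPrime →
      Disjoint (P : Set (AddMonoidAlgebra R G)) S → P.height ≤ d) ∧
    ∀ s ∈ S, ∃ (φ : G →+ ℤ) (g₀ : G), IsLowest φ g₀ s ∧ (Nontrivial G → ∃ t, 0 < φ t)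

variable {R : Type*} [CommRing R] {G G' : Type*} [AddCommGroup G] [AddCommGroup G'] {d : ℕ}

lemma hasLowestSystem_of_subsingleton [Subsingleton G] (hd : ringKrullDim R ≤ d) :
    HasLowestSystem R G d := by
  refine ⟨⊥, fun P hP _ => ?_, ?_⟩
  · have hP' : (P.comap (AddMonoidAlgebra.uniqueRingEquiv (R := R) G).symm).IsPrime :=
      Ideal.comap_isPrime _ P
    rw [← (AddMonoidAlgebra.uniqueRingEquiv (R := R) G).symm.height_comap P]
    have := (Ideal.height_le_ringKrullDim_of_isPrime
      (I := P.comap (AddMonoidAlgebra.uniqueRingEquiv (R := R) G).symm)).trans hd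
    exact_mod_cast this
  · intro s hs
    rw [Submonoid.mem_bot] at hs
    subst hs
    refine ⟨0, 0, ?_, fun h => (not_nontrivial G h).elim⟩
    rw [IsLowest, AddMonoidAlgebra.one_def, sub_self]
    exact zero_mem _

lemma disjoint_comap_symm {A B : Type*} [CommRing A] [CommRing B] (e : A ≃+* B) (S : Submonoid B)
    (P : Ideal A) (h : Disjoint (P : Set A) (S.comap e : Submonoid A)) :
    Disjoint ((P.comap e.symm : Ideal B) : Set B) S := by
  rw [Set.disjoint_left] at h ⊢
  intro b hb hbS
  refine h (a := e.symm b) hb ?_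
  change e (e.symm b) ∈ S
  rwa [e.apply_symm_apply]

lemma HasLowestSystem.of_addEquiv (e : G ≃+ G') (h : HasLowestSystem R G d) :
    HasLowestSystem R G' d := by
  obtain ⟨S, hS, hS'⟩ := h
  let E : AddMonoidAlgebra R G' ≃+* AddMonoidAlgebra R G :=
    AddMonoidAlgebra.mapDomainRingEquiv R e.symm
  refine ⟨S.comap E, fun P hP hPS => ?_, fun s hs => ?_⟩
  · rw [← E.symm.height_comap P]
    exact hS _ (Ideal.comap_isPrime _ P) (disjoint_comap_symm E S P hPS)
  · obtain ⟨φ, g₀, h1, h2⟩ := hS' _ hs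
    refine ⟨φ.comp e.symm.toAddMonoidHom, e g₀, ?_, fun hG' => ?_⟩
    · rw [isLowest_iff] at h1 ⊢
      have hc : ∀ g, (E s).coeff g = s.coeff (e g) := fun g => by
        rw [AddMonoidAlgebra.coeff_mapDomainRingEquiv, Finsupp.equivMapDomain_apply]
        rfl
      refine ⟨by rw [← hc, h1.1], fun g hg hsg => ?_⟩
      have := h1.2 (e.symm g) (fun h => hg (by rw [← h, e.apply_symm_apply]))
        (by rw [hc, e.apply_symm_apply]; exact hsg)
      simpa using this
    · obtain ⟨t, ht⟩ := h2 e.toEquiv.nontrivial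
      exact ⟨e t, by simpa using ht⟩

lemma coeff_curryRingEquiv (f : AddMonoidAlgebra R (ℤ × G)) (k : ℤ) (g : G) :
    ((AddMonoidAlgebra.curryRingEquiv f).coeff k).coeff g = f.coeff (k, g) := by
  classical
  induction f using AddMonoidAlgebra.induction_linear with
  | zero => simp
  | add f f' h h' => simp [h, h']
  | single a r =>
    obtain ⟨l, g'⟩ := a
    rw [AddMonoidAlgebra.curryRingEquiv_single, AddMonoidAlgebra.coeff_single,
      AddMonoidAlgebra.coeff_single, Finsupp.single_apply, Finsupp.single_apply]
    by_cases h : l = k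
    · simp [h, Finsupp.single_apply]
    · simp [h]

/-- Over `R[G]` the ring is one of Laurent polynomials, and the new set asks the lowest coefficient
to lie in the old one. The form combines the degree in the new variable, heavily weighted, with the
old form, so that it imitates a lexicographic order. -/
lemma HasLowestSystem.int_prod [IsNoetherianRing (AddMonoidAlgebra R G)]
    (h : HasLowestSystem R G d) : HasLowestSystem R (ℤ × G) d := by
  obtain ⟨S, hS, hS'⟩ := h
  let E : AddMonoidAlgebra R (ℤ × G) ≃+* LaurentPolynomial (AddMonoidAlgebra R G) :=
    AddMonoidAlgebra.curryRingEquiv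
  refine ⟨(lowestCoeffSubmonoid S).comap E, fun P hP hPS => ?_, fun s hs => ?_⟩
  · rw [← E.symm.height_comap P]
    exact height_le_of_disjoint_lowestCoeffSubmonoid S d hS _ (Ideal.comap_isPrime _ P)
      (disjoint_comap_symm E _ P hPS)
  · obtain ⟨k, hk, hlow⟩ := hs
    obtain ⟨φ, g₀, h1, -⟩ := hS' _ hk
    rw [isLowest_iff] at h1
    -- The weight exceeds every difference of `φ`-values that occurs on the support, so the first
    -- coordinate dominates.
    set N : ℕ := 1 + ∑ q ∈ s.coeff.support, (φ g₀ - φ q.2).natAbs with hN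
    refine ⟨(N • AddMonoidHom.fst ℤ G) + φ.comp (AddMonoidHom.snd ℤ G), (k, g₀), ?_,
      fun _ => ⟨(1, 0), by simp [hN]; positivity⟩⟩
    rw [isLowest_iff]
    constructor
    · rw [← coeff_curryRingEquiv]
      exact h1.1
    · rintro ⟨l, g⟩ hne hlg
      have hkl : k ≤ l := by
        by_contra! hlt
        apply hlg
        rw [← coeff_curryRingEquiv]
        have : (E s).coeff l = 0 := hlow l hlt
        change ((E s).coeff l).coeff g = 0
        rw [this]
        rfl
      simp only [AddMonoidHom.add_apply, AddMonoidHom.nsmul_apply, AddMonoidHom.coe_fst,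
        AddMonoidHom.comp_apply, AddMonoidHom.coe_snd, nsmul_eq_mul]
      rcases hkl.eq_or_lt with rfl | hlt
      · have := h1.2 g (fun e => hne (by rw [e])) (by
          change ((AddMonoidAlgebra.curryRingEquiv s).coeff k).coeff g ≠ 0
          rwa [coeff_curryRingEquiv])
        omega
      · have h2 := Finset.single_le_sum (f := fun q : ℤ × G => (φ g₀ - φ q.2).natAbs)
          (fun _ _ => Nat.zero_le _) (Finsupp.mem_support_iff.2 hlg)
        simp only at h2
        have h3 : (N : ℤ) * (k + 1) ≤ N * l := by
          have : k + 1 ≤ l := hlt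
          gcongr
        have h4 : (φ g₀ - φ g).natAbs < N := by omega
        rw [mul_add, mul_one] at h3
        have h5 : (N : ℤ) * k + (φ g₀ - φ g) < N * l := by omega
        linarith

instance isNoetherianRing_addMonoidAlgebra_int [IsNoetherianRing R] (r : ℕ) :
    IsNoetherianRing (AddMonoidAlgebra R (Fin r → ℤ)) := by
  have : AddGroup.FG (Fin r → ℤ) := Module.Finite.iff_addGroup_fg.1 inferInstance
  have : AddMonoid.FG (Fin r → ℤ) := AddGroup.fg_iff_addMonoid_fg.1 this
  exact Algebra.FiniteType.isNoetherianRing R _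

lemma hasLowestSystem_int [IsNoetherianRing R] (hd : ringKrullDim R ≤ d) (r : ℕ) :
    HasLowestSystem R (Fin r → ℤ) d := by
  induction r with
  | zero => exact hasLowestSystem_of_subsingleton hd
  | succ r ih =>
    exact ih.int_prod.of_addEquiv (Fin.consLinearEquiv ℤ fun _ : Fin (r + 1) => ℤ).toAddEquiv

end LowestSystem

/-! ### Group rings of lattices -/

section GroupRings

variable {T : ClassicalType} {n : ℕ} {R : Type*} [CommRing R] {G : Type*} [AddCommGroup G]

/-- The numerical form of the stable range condition for rings of dimension at most `d`. -/
def StableRange (T : ClassicalType) (n d : ℕ) : Prop :=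
  match T with
  | .symplectic => d + 2 ≤ 2 * n
  | .orthogonal => d + 2 ≤ n

/-- A multiple of an element of `S` by a monomial of very negative degree can be added to the
coordinate, and its lowest term then prevails. -/
lemma exists_rel_isLowest [IsNoetherianRing (AddMonoidAlgebra R G)] [Nontrivial G] {d : ℕ}
    (hS : HasLowestSystem R G d) (hn : StableRange T n d)
    {v w : Pos n → AddMonoidAlgebra R G} (hw : v ⬝ᵥ w = 1) (k : Fin n) :
    ∃ (v' : Pos n → AddMonoidAlgebra R G) (φ : G →+ ℤ) (g t : G),
      Rel T v v' ∧ IsLowest φ g (v' (k, 0)) ∧ 0 < φ t := by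
  obtain ⟨S, hS, hlow⟩ := hS
  have key : ∃ v', Rel T v v' ∧ ∃ s ∈ S, ∀ t, ∃ v'', Rel T v' v'' ∧
      v'' (k, 0) = v' (k, 0) + t * s := by
    cases T
    · exact exists_rel_add_mul_symplectic S d hn hS hw (k, 0)
    · exact exists_rel_add_mul_orthogonal S d hn hS hw k
  obtain ⟨v', h1, s, hs, h2⟩ := key
  obtain ⟨φ, g₀, hφ, ht⟩ := hlow s hs
  obtain ⟨t, ht⟩ := ht inferInstance
  obtain ⟨N, hN⟩ := exists_mem_filt φ (v' (k, 0))
  -- This is large enough to push `-m φ(t) + φ(g₀)` strictly below `-N`, a lower bound for the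
  -- degrees in the old coordinate.
  set m : ℕ := N + (φ g₀).natAbs + 1 with hm
  obtain ⟨v'', h3, h4⟩ := h2 (AddMonoidAlgebra.single (-(m • t)) 1)
  refine ⟨v'', φ, -(m • t) + g₀, t, h1.trans h3, ?_, ht⟩
  have h5 : φ (-(m • t) + g₀) = -(m * φ t) + φ g₀ := by simp
  have h6 : (m : ℤ) ≤ m * φ t := le_mul_of_one_le_right (by positivity) ht
  have h7 : v'' (k, 0) - AddMonoidAlgebra.single (-(m • t) + g₀) 1 =
      v' (k, 0) + AddMonoidAlgebra.single (-(m • t)) 1 * (s - AddMonoidAlgebra.single g₀ 1) := by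
    rw [h4, mul_sub, AddMonoidAlgebra.single_mul_single, mul_one]
    ring
  rw [IsLowest, h7]
  refine add_mem (filt_mono ?_ hN) (filt_mono ?_ (mul_mem_filt
    (single_mem_filt (R := R) (φ := φ) (-(m • t)) 1 le_rfl) hφ))
  · rw [h5]; omega
  · rw [h5]
    have : φ (-(m • t)) = -(m * φ t) := by simp
    rw [this]; omega

/-- The coordinate `(k, 0)` serves to turn `(l, 0)` into a pivot of positive degree `φ t`; that
pivot then clears the other pairs. The entry `(l, 1)` is adjusted freely in the symplectic case and
is controlled by `quad = 0` in the orthogonal case. -/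
lemma exists_rel_sub_single_mem_filt {φ : G →+ ℤ} {g t : G} (ht : 0 < φ t) {k l : Fin n}
    (hkl : k ≠ l) {v : Pos n → AddMonoidAlgebra R G} (hv : IsLowest φ g (v (k, 0)))
    (hq : T = .orthogonal → quad v = 0) :
    ∃ v', Rel T v v' ∧ ∀ j, v' j - (Pi.single (k, 0) 1 : Pos n → AddMonoidAlgebra R G) j ∈
      filt R φ 1 := by
  classical
  obtain ⟨c, hc⟩ := hv.exists_add_mul_mem_filt (v (l, 0)) (φ t + 1)
  obtain ⟨v₁, y₁, h1, -, h2, -, -⟩ := exists_rel_transvection (T := T) v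
    (Pi.single (l, 0) (c + AddMonoidAlgebra.single (t - g) 1)) (k, 0)
  have hlow : IsLowest φ t (v₁ (l, 0)) := by
    rw [IsLowest, h2 _ hkl.symm, Pi.single_eq_same]
    have h3 : v (l, 0) + (c + AddMonoidAlgebra.single (t - g) 1) * v (k, 0) -
        AddMonoidAlgebra.single t 1 = (v (l, 0) + c * v (k, 0)) +
        AddMonoidAlgebra.single (t - g) 1 * (v (k, 0) - AddMonoidAlgebra.single g 1) := by
      rw [mul_sub, AddMonoidAlgebra.single_mul_single, sub_add_cancel, mul_one]
      ring
    rw [h3]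
    refine add_mem hc (filt_mono ?_ (mul_mem_filt
      (single_mem_filt (R := R) (φ := φ) (t - g) 1 le_rfl) hv))
    rw [map_sub]; omega
  -- Degree `φ t + 1`, rather than `1`, leaves room for the division by the pivot of degree `φ t`
  -- that bounds the entry `(l, 1)`.
  choose x hx using fun j => hlow.exists_add_mul_mem_filt
    (v₁ j - (Pi.single (k, 0) 1 : Pos n → AddMonoidAlgebra R G) j) (φ t + 1)
  have hne : ∀ e : Fin 2, ((l, e) : Pos n) ≠ (k, 0) := fun e h => hkl (congrArg Prod.fst h).symm
  suffices H : ∃ v', Rel T v₁ v' ∧ v' (l, 0) = v₁ (l, 0) ∧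
      (∀ j, j.1 ≠ l → v' j = v₁ j + x j * v₁ (l, 0)) ∧ v' (l, 1) ∈ filt R φ 1 by
    obtain ⟨v', h3, h4, h5, h6⟩ := H
    refine ⟨v', h1.trans h3, ?_⟩
    rintro ⟨j, e⟩
    by_cases hj : j = l
    · subst hj
      rw [Pi.single_eq_of_ne (hne e), sub_zero]
      fin_cases e
      · change v' (j, 0) ∈ _
        rw [h4]
        exact filt_mono ht hlow.mem_filt
      · exact h6
    · rw [h5 _ hj, add_sub_right_comm]
      exact filt_mono (by omega) (hx (j, e))
  have horth : ∀ v' : Pos n → AddMonoidAlgebra R G, v' (l, 0) = v₁ (l, 0) →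
      (∀ j, j.1 ≠ l → v' j = v₁ j + x j * v₁ (l, 0)) → quad v' = 0 → v' (l, 1) ∈ filt R φ 1 := by
    intro v' h4 h5 hq'
    refine hlow.mem_filt_of_mul ?_
    rw [quad, ← Finset.add_sum_erase _ _ (Finset.mem_univ l)] at hq'
    rw [← h4, eq_neg_of_add_eq_zero_left hq']
    refine neg_mem (sum_mem fun j hj => ?_)
    have hj := Finset.ne_of_mem_erase hj
    have h6 : ∀ e, v' (j, e) - (Pi.single (k, 0) 1 : Pos n → AddMonoidAlgebra R G) (j, e) ∈
        filt R φ (φ t + 1) := fun e => by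
      rw [h5 _ hj, add_sub_right_comm]
      exact hx (j, e)
    have h7 : v' (j, 0) ∈ filt R φ 0 := by
      have := add_mem (filt_mono (by omega) (h6 0)) (show
        (Pi.single (k, 0) 1 : Pos n → AddMonoidAlgebra R G) (j, 0) ∈ filt R φ 0 by
          rw [Pi.single_apply]
          split_ifs
          · exact one_mem_filt
          · exact zero_mem _)
      rwa [sub_add_cancel] at this
    have h8 := h6 1
    rw [Pi.single_eq_of_ne (by simp), sub_zero] at h8
    exact filt_mono (by omega) (mul_mem_filt h7 h8)
  cases T
  · obtain ⟨c, hc⟩ := hlow.exists_add_mul_mem_filt (v₁ (l, 1) -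
      ∑ j with j.1 ≠ l, sgn .symplectic _ (l, 0) j * x j * v₁ (swap j)) 1
    obtain ⟨v', h3, h4, h5, h6⟩ := exists_rel_transvection_symplectic v₁ x (l, 0) c
    exact ⟨v', h3, h4, h5, by rw [← swap_mk_zero, h6]; exact hc⟩
  · obtain ⟨v', y, h3, h4, h5, -, -⟩ := exists_rel_transvection (T := .orthogonal) v₁ x (l, 0)
    exact ⟨v', h3, h4, h5, horth v' h4 h5 (by rw [h3.quad_eq, h1.quad_eq, hq rfl])⟩

/-- If `2a = 0`, the row `e₁ + a e₂` satisfies the isotropy condition. It lies in the orbit of `e₁`,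
whose `quad` is zero, while its own is `a`. -/
lemma eq_zero_of_two_mul_eq_zero {K : Type*} [AddCommMonoid K] (hn : 0 < n)
    (h : TrivialOrbitSpace .orthogonal n (AddMonoidAlgebra R K)) (a : R) (ha : 2 * a = 0) :
    a = 0 := by
  classical
  set k : Fin n := ⟨0, hn⟩
  set b : AddMonoidAlgebra R K := AddMonoidAlgebra.single 0 a with hb
  have hquad : ∀ b : AddMonoidAlgebra R K,
      quad (Pi.single (k, 0) 1 + Pi.single (k, 1) b : Pos n → AddMonoidAlgebra R K) = b := by
    intro b
    rw [quad, Finset.sum_eq_single k]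
    · simp
    · intro j _ hj
      simp [hj]
    · simp
  have h1 : (Pi.single (k, 0) 1 + Pi.single (k, 1) b : Pos n → AddMonoidAlgebra R K) ∈
      Um .orthogonal n (AddMonoidAlgebra R K) := by
    rw [mem_Um_iff]
    refine ⟨⟨Pi.single (k, 0) 1, by simp⟩, fun _ => ?_⟩
    rw [hquad, two_mul, hb, ← AddMonoidAlgebra.single_add, ← two_mul, ha,
      AddMonoidAlgebra.single_zero]
  have h2 := (show Rel .orthogonal _ _ from h _ h1 _ (single_mem_Um (k, 0))).quad_eq
  have h3 := hquad 0
  rw [Pi.single_zero, add_zero] at h3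
  rw [h3, hquad, hb] at h2
  have := congrArg (fun f => f.coeff 0) h2
  simpa using this.symm

lemma coeff_two_mul {K : Type*} [AddCommMonoid K] (hR : ∀ a : R, 2 * a = 0 → a = 0)
    {x : AddMonoidAlgebra R K} (hx : 2 * x = 0) : x = 0 := by
  ext g
  have := congrArg (fun f => f.coeff g) hx
  refine hR _ ?_
  rw [two_mul] at this ⊢
  simpa using this

variable {r : ℕ}

lemma isOpenSubmonoid_pos {G : Type*} [AddCommGroup G] [IsAddTorsionFree G] (φ : G →+ ℤ) :
    ∃ H : AddSubmonoid G, (∀ g, g ∈ H ↔ 0 < φ g ∨ g = 0) ∧ IsOpenSubmonoid ⊤ H := by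
  let H : AddSubmonoid G :=
    { carrier := {g | 0 < φ g ∨ g = 0}
      zero_mem' := Or.inr rfl
      add_mem' := by
        rintro a b (ha | rfl) (hb | rfl)
        · left; rw [map_add]; omega
        · left; simpa using ha
        · left; simpa using hb
        · right; simp }
  have hmem : ∀ g, g ∈ H ↔ 0 < φ g ∨ g = 0 := fun g => Iff.rfl
  refine ⟨H, hmem, fun _ _ => AddSubgroup.mem_top _, ?_, ?_, ?_⟩
  · intro x hx hx0 y _
    have hpos : 0 < φ x := ((hmem x).1 hx).resolve_right hx0
    refine ⟨(φ y).natAbs + 1, (hmem _).2 (Or.inl ?_)⟩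
    rw [map_add, map_nsmul, nsmul_eq_mul]
    have : (((φ y).natAbs + 1 : ℕ) : ℤ) ≤ ((φ y).natAbs + 1 : ℕ) * φ x :=
      le_mul_of_one_le_right (by positivity) hpos
    omega
  · intro x hx y hy hxy
    rcases (hmem x).1 hx with hx | hx
    · have h1 : 0 ≤ φ y := by
        rcases (hmem y).1 hy with hy | rfl
        · exact hy.le
        · simp
      have h2 := congrArg φ hxy
      rw [map_add, map_zero] at h2
      omega
    · exact hx
  · intro z _ c hc hz
    rcases (hmem _).1 hz with hz | hz
    · rw [map_nsmul, nsmul_eq_mul] at hz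
      exact (hmem z).2 (Or.inl (pos_of_mul_pos_right hz (by positivity)))
    · exact (hmem z).2 (Or.inr ((nsmul_eq_zero_iff_right hc.ne').1 hz))

/-- After reduction the row is the unit vector plus terms of positive `φ`-degree, so it descends to
the open monoid `{φ > 0} ∪ {0}`. The rank zero case is itself an open monoid. -/
theorem trivialOrbitSpace_int [IsNoetherianRing R] {d : ℕ} (hd : ringKrullDim R ≤ d)
    (hn : StableRange T n d) (hn' : 2 ≤ n)
    (hN : ∀ (N : Type) [AddCommMonoid N], IsAffine N → IsPositive N → IsNormal N →
      TrivialOrbitSpace T n (AddMonoidAlgebra R (interiorMonoid N))) (r : ℕ) :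
    TrivialOrbitSpace T n (AddMonoidAlgebra R (Fin r → ℤ)) := by
  rcases subsingleton_or_nontrivial (Fin r → ℤ) with hG | hG
  · refine trivialOrbitSpace_of_addEquiv AddSubmonoid.topEquiv
      (trivialOrbitSpace_of_isOpenSubmonoid hN (L := ⊤) (H := ⊤) ⟨?_, ?_, ?_, ?_⟩)
    · exact fun _ _ => AddSubgroup.mem_top _
    · exact fun _ _ _ _ _ => ⟨0, AddSubmonoid.mem_top _⟩
    · exact fun _ _ _ _ _ => Subsingleton.elim _ _
    · exact fun _ _ _ _ _ => AddSubmonoid.mem_top _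
  set k : Fin n := ⟨0, by omega⟩
  set l : Fin n := ⟨1, by omega⟩
  have hkl : k ≠ l := by simp [k, l]
  refine trivialOrbitSpace_of_forall_rel (k, 0) fun v hv => ?_
  obtain ⟨w, hw⟩ := hv.1
  obtain ⟨v₁, φ, g, t, h1, hlow, ht⟩ := exists_rel_isLowest (hasLowestSystem_int hd r) hn hw k
  obtain ⟨H, hH, hHo⟩ := isOpenSubmonoid_pos φ
  have hHtriv := trivialOrbitSpace_of_isOpenSubmonoid hN hHo
  obtain ⟨v₂, h2, h3⟩ := exists_rel_sub_single_mem_filt (T := T) ht hkl hlow (by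
    rintro rfl
    exact coeff_two_mul (eq_zero_of_two_mul_eq_zero (by omega) hHtriv)
      ((mem_Um_iff.1 (h1.mem_Um hv)).2 rfl))
  set f := AddMonoidAlgebra.mapDomainRingHom R H.subtype
  have hf : Function.Injective f := mapDomainRingHom_injective _ Subtype.val_injective
  have hrange : ∀ x ∈ filt R φ 1, x ∈ Set.range f := fun x hx =>
    mem_range_mapDomainRingHom _ Subtype.val_injective fun g hg =>
      ⟨⟨g, (hH g).2 (Or.inl (hx g hg))⟩, rfl⟩
  have hv₂ : ∀ j, v₂ j ∈ Set.range f := by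
    intro j
    obtain ⟨a, ha⟩ := hrange _ (h3 j)
    refine ⟨a + (Pi.single (k, 0) 1 : Pos n → AddMonoidAlgebra R H) j, ?_⟩
    rw [map_add, ha, Pi.single_apply, Pi.single_apply]
    split_ifs <;> simp
  choose u hu using hv₂
  have hu' : f ∘ u = v₂ := funext hu
  have hv₂ : v₂ ∈ Um T n _ := h2.mem_Um (h1.mem_Um hv)
  obtain ⟨w', hw'⟩ := hv₂.1
  choose M hM using fun j => exists_mem_filt φ (w' j)
  -- The inverse row may have negative degrees, but `1 - v₂ (k, 0)` has positive degree, and a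
  -- sufficiently high power of it compensates.
  have hum : ∃ w, u ⬝ᵥ w = 1 := by
    refine exists_dotProduct_eq_one f hf (w := w') (hu' ▸ hw') (k, 0) (∑ j, M j + 1) fun j => ?_
    refine hrange _ (filt_mono ?_ (mul_mem_filt (hM j) (pow_mem_filt (N := ∑ j, M j + 1) ?_)))
    · have := Finset.single_le_sum (fun j _ => Nat.zero_le (M j)) (Finset.mem_univ j)
      push_cast
      have : (M j : ℤ) ≤ ∑ j, (M j : ℤ) := by exact_mod_cast this
      linarith
    · rw [map_sub, map_one, hu, ← neg_sub]
      have := h3 (k, 0)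
      rw [Pi.single_eq_same] at this
      exact neg_mem this
  have h4 : Rel T u (Pi.single (k, 0) 1) :=
    hHtriv u (mem_Um_of_map f hf (hu' ▸ hv₂) hum) _ (single_mem_Um _)
  have h5 := h4.map f
  rw [hu'] at h5
  have h6 : f ∘ (Pi.single (k, 0) 1 : Pos n → AddMonoidAlgebra R H) = Pi.single (k, 0) 1 := by
    ext1 j
    rw [Function.comp_apply, Pi.single_apply, Pi.single_apply]
    split_ifs <;> simp
  rw [h6] at h5
  exact (h1.trans h2).trans h5

end GroupRings

/-! ### Faces of submonoids -/

section Faces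

variable {Γ : Type*} [AddCommGroup Γ] {K F G : AddSubmonoid Γ}

/-- `F` is a face of `K`. -/
structure IsFace (K F : AddSubmonoid Γ) : Prop where
  le : F ≤ K
  mem_left : ∀ a ∈ K, ∀ b ∈ K, a + b ∈ F → a ∈ F

lemma IsFace.mem_right (hF : IsFace K F) {a b : Γ} (ha : a ∈ K) (hb : b ∈ K) (h : a + b ∈ F) :
    b ∈ F := hF.mem_left b hb a ha (by rwa [add_comm])

lemma IsFace.refl (K : AddSubmonoid Γ) : IsFace K K := ⟨le_rfl, fun _ ha _ _ _ => ha⟩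

/-- The smallest face of `K` containing `g`. -/
def faceOf (K : AddSubmonoid Γ) (g : Γ) (hg : g ∈ K) : AddSubmonoid Γ where
  carrier := {x | x ∈ K ∧ ∃ k : ℕ, k • g - x ∈ K}
  zero_mem' := ⟨zero_mem _, 1, by simpa using hg⟩
  add_mem' := by
    rintro a b ⟨ha, k, hk⟩ ⟨hb, l, hl⟩
    refine ⟨add_mem ha hb, k + l, ?_⟩
    convert add_mem hk hl using 1
    rw [add_smul]; abel

lemma isFace_faceOf {g : Γ} (hg : g ∈ K) : IsFace K (faceOf K g hg) := by
  refine ⟨fun x hx => hx.1, ?_⟩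
  rintro a ha b hb ⟨-, k, hk⟩
  refine ⟨ha, k, ?_⟩
  convert add_mem hk hb using 1
  abel

lemma mem_faceOf {g : Γ} (hg : g ∈ K) : g ∈ faceOf K g hg := ⟨hg, 1, by simp⟩

lemma IsFace.faceOf_le (hF : IsFace K F) {g : Γ} (hg : g ∈ F) : faceOf K g (hF.le hg) ≤ F := by
  rintro x ⟨hx, k, hk⟩
  refine hF.mem_left x hx _ hk ?_
  rw [add_sub_cancel]
  exact nsmul_mem hg k

/-- The interior of `F` together with zero. -/
def openInterior (F : AddSubmonoid Γ) : AddSubmonoid Γ where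
  carrier := {x | (x ∈ F ∧ ∀ y ∈ F, ∃ k : ℕ, k • x - y ∈ F) ∨ x = 0}
  zero_mem' := Or.inr rfl
  add_mem' := by
    rintro a b (⟨ha, ha'⟩ | rfl) (⟨hb, hb'⟩ | rfl)
    · refine Or.inl ⟨add_mem ha hb, fun y hy => ?_⟩
      obtain ⟨k, hk⟩ := ha' y hy
      refine ⟨k, ?_⟩
      convert add_mem hk (nsmul_mem hb k) using 1
      rw [smul_add]; abel
    · rw [add_zero]; exact Or.inl ⟨ha, ha'⟩
    · rw [zero_add]; exact Or.inl ⟨hb, hb'⟩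
    · rw [add_zero]; exact Or.inr rfl

lemma mem_openInterior {x : Γ} : x ∈ openInterior F ↔
    (x ∈ F ∧ ∀ y ∈ F, ∃ k : ℕ, k • x - y ∈ F) ∨ x = 0 := Iff.rfl

lemma openInterior_le : openInterior F ≤ F := by
  rintro x (h | rfl)
  · exact h.1
  · exact zero_mem _

lemma add_mem_openInterior {x y : Γ} (hx : x ∈ openInterior F) (hx0 : x ≠ 0) (hy : y ∈ F) :
    y + x ∈ openInterior F := by
  obtain ⟨h1, h2⟩ := (mem_openInterior.1 hx).resolve_right hx0
  refine Or.inl ⟨add_mem hy h1, fun z hz => ?_⟩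
  obtain ⟨k, hk⟩ := h2 z hz
  refine ⟨k, ?_⟩
  convert add_mem hk (nsmul_mem hy k) using 1
  rw [smul_add]; abel

lemma IsFace.mem_openInterior_or (hF : IsFace K F) {g : Γ} (hg : g ∈ F) :
    g ∈ openInterior F ∨ faceOf K g (hF.le hg) ≠ F := by
  by_contra! h
  refine h.1 (Or.inl ⟨hg, fun y hy => ?_⟩)
  rw [← h.2] at hy
  obtain ⟨hyK, k, hk⟩ := hy
  refine ⟨k, hF.mem_right hyK hk ?_⟩
  rw [add_sub_cancel]
  exact nsmul_mem hg k

/-- A nonzero interior element of `F` has multiples dominating every element of `F`, so a face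
containing it contains `F`. -/
lemma IsFace.eq_zero_of_mem_openInterior (hF : F ≤ K) (hG : IsFace K G) (hFG : ¬ F ≤ G) {x : Γ}
    (hx : x ∈ openInterior F) (hxG : x ∈ G) : x = 0 := by
  by_contra hx0
  obtain ⟨-, h2⟩ := (mem_openInterior.1 hx).resolve_right hx0
  refine hFG fun y hy => ?_
  obtain ⟨k, hk⟩ := h2 y hy
  refine hG.mem_left y (hF hy) _ (hF hk) ?_
  rw [add_sub_cancel]
  exact nsmul_mem hxG k

/-- The face of units. -/
def unitFace (K : AddSubmonoid Γ) : AddSubmonoid Γ where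
  carrier := {x | x ∈ K ∧ -x ∈ K}
  zero_mem' := ⟨zero_mem _, by simp⟩
  add_mem' := by
    rintro a b ⟨ha, ha'⟩ ⟨hb, hb'⟩
    exact ⟨add_mem ha hb, by rw [neg_add]; exact add_mem ha' hb'⟩

lemma isFace_unitFace : IsFace K (unitFace K) := by
  refine ⟨fun x hx => hx.1, ?_⟩
  rintro a ha b hb ⟨-, h⟩
  refine ⟨ha, ?_⟩
  convert add_mem h hb using 1
  abel

lemma IsFace.unitFace_le (hF : IsFace K F) : unitFace K ≤ F := by
  rintro x ⟨h1, h2⟩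
  exact hF.mem_left x h1 _ h2 (by rw [add_neg_cancel]; exact zero_mem _)

/-- The essential point is saturation, where seminormality enters: if `c z` is interior to `F`, then
all large multiples of `z` lie in `K`, and this forces `z ∈ K`. -/
lemma IsFace.isOpenSubmonoid_openInterior [IsAddTorsionFree Γ] (hF : IsFace K F)
    (hFU : F ≠ unitFace K) (hK : ∀ x, 2 • x ∈ K → 3 • x ∈ K → x ∈ K) :
    IsOpenSubmonoid (AddSubgroup.closure (F : Set Γ)) (openInterior F) := by
  have hFU' : ¬ F ≤ unitFace K := fun h => hFU (le_antisymm h hF.unitFace_le)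
  have habs : ∀ x ∈ openInterior F, x ≠ 0 → ∀ y ∈ AddSubgroup.closure (F : Set Γ),
      ∃ k : ℕ, k • x + y ∈ openInterior F := by
    intro x hx hx0 y hy
    obtain ⟨a, ha, b, hb, rfl⟩ : ∃ a ∈ F, ∃ b ∈ F, y = a - b := by
      induction hy using AddSubgroup.closure_induction with
      | mem y hy => exact ⟨y, hy, 0, zero_mem _, by simp⟩
      | zero => exact ⟨0, zero_mem _, 0, zero_mem _, by simp⟩
      | add y z _ _ hy hz =>
        obtain ⟨a, ha, b, hb, rfl⟩ := hy
        obtain ⟨c, hc, d, hd, rfl⟩ := hz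
        exact ⟨a + c, add_mem ha hc, b + d, add_mem hb hd, by abel⟩
      | neg y _ hy =>
        obtain ⟨a, ha, b, hb, rfl⟩ := hy
        exact ⟨b, hb, a, ha, by abel⟩
    obtain ⟨k, hk⟩ := ((mem_openInterior.1 hx).resolve_right hx0).2 b hb
    refine ⟨k + 1, ?_⟩
    convert add_mem_openInterior hx hx0 (add_mem hk ha) using 1
    rw [add_smul, one_smul]; abel
  refine ⟨fun x hx => AddSubgroup.subset_closure (openInterior_le hx), habs, ?_, ?_⟩
  · intro x hx y hy hxy
    refine IsFace.eq_zero_of_mem_openInterior hF.le isFace_unitFace hFU' hx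
      ⟨hF.le (openInterior_le hx), ?_⟩
    rw [neg_eq_of_add_eq_zero_right hxy]
    exact hF.le (openInterior_le hy)
  · intro z hz c hc hcz
    by_cases hz0 : c • z = 0
    · exact Or.inr ((nsmul_eq_zero_iff_right hc.ne').1 hz0)
    -- One absorption constant for each residue class modulo `c`; beyond all of them, division with
    -- remainder writes `m z` as a sum of elements of `F`.
    choose k hk using fun ρ : ℕ => habs _ hcz hz0 (ρ • z) (nsmul_mem hz ρ)
    have hlarge : ∀ m : ℕ, c * ∑ ρ ∈ Finset.range c, k ρ ≤ m → m • z ∈ K := by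
      intro m hm
      have h1 : k (m % c) ≤ m / c := by
        refine (Finset.single_le_sum (fun _ _ => Nat.zero_le _)
          (Finset.mem_range.2 (Nat.mod_lt m hc))).trans ?_
        rw [Nat.le_div_iff_mul_le hc, mul_comm]
        exact hm
      obtain ⟨q, hq⟩ := Nat.exists_eq_add_of_le h1
      have h2 : m • z = q • (c • z) + (k (m % c) • (c • z) + (m % c) • z) := by
        rw [smul_smul, smul_smul, ← add_smul, ← add_smul]
        congr 1
        conv_lhs => rw [← Nat.div_add_mod m c, hq]
        ring
      rw [h2]
      exact hF.le (openInterior_le (add_mem (nsmul_mem hcz q) (hk _)))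
    -- For `m ≥ N ≥ 1` both `2m` and `3m` are at least `N + 1`, so the threshold can be lowered by
    -- one.
    have hdesc : ∀ N : ℕ, (∀ m, N ≤ m → m • z ∈ K) → z ∈ K := by
      intro N
      induction N with
      | zero => exact fun h => by simpa using h 1 (by omega)
      | succ N ih =>
        intro h
        rcases Nat.eq_zero_or_pos N with rfl | hN
        · simpa using h 1 le_rfl
        refine ih fun m hm => ?_
        refine hK _ ?_ ?_ <;> rw [smul_smul] <;> exact h _ (by omega)
    have hzK := hdesc _ hlarge
    have hzF : z ∈ F := by
      obtain ⟨b, rfl⟩ := Nat.exists_eq_add_of_lt hc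
      refine hF.mem_left z hzK (b • z) (nsmul_mem hzK b) ?_
      have := openInterior_le hcz
      rw [zero_add, add_smul, one_smul, add_comm] at this
      exact this
    refine Or.inl ⟨hzF, fun y hy => ?_⟩
    obtain ⟨l, hl⟩ := ((mem_openInterior.1 hcz).resolve_right hz0).2 y hy
    exact ⟨l * c, by rwa [mul_smul]⟩

/-- A face is determined by its intersection with `X`, since a sum lies in it exactly when all
summands do. -/
lemma finite_setOf_isFace (X : Finset Γ) (hX : ∀ x ∈ X, x ∈ K)
    (hKX : ∀ z ∈ K, ∃ c : ℕ, 0 < c ∧ c • z ∈ AddSubmonoid.closure (X : Set Γ)) :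
    {F | IsFace K F}.Finite := by
  classical
  refine Set.Finite.of_finite_image (f := fun F => (F : Set Γ) ∩ X)
    ((X.finite_toSet.powerset).subset ?_) ?_
  · rintro _ ⟨F, -, rfl⟩
    exact Set.inter_subset_right
  · have key : ∀ F G : AddSubmonoid Γ, IsFace K F → IsFace K G →
        (F : Set Γ) ∩ X ⊆ (G : Set Γ) ∩ X → F ≤ G := by
      intro F G hF hG h z hz
      obtain ⟨c, hc, hcz⟩ := hKX z (hF.le hz)
      have h1 : ∀ y, y ∈ AddSubmonoid.closure (X : Set Γ) → y ∈ K ∧ (y ∈ F → y ∈ G) := by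
        intro y hy
        induction hy using AddSubmonoid.closure_induction with
        | mem y hy => exact ⟨hX y hy, fun hyF => (h ⟨hyF, hy⟩).1⟩
        | zero => exact ⟨zero_mem _, fun _ => zero_mem _⟩
        | add y z _ _ hy hz =>
          exact ⟨add_mem hy.1 hz.1, fun hyz => add_mem (hy.2 (hF.mem_left y hy.1 z hz.1 hyz))
            (hz.2 (hF.mem_right hy.1 hz.1 hyz))⟩
      have h2 := (h1 _ hcz).2 (nsmul_mem hz c)
      obtain ⟨b, rfl⟩ := Nat.exists_eq_add_of_lt hc
      rw [zero_add, add_smul, one_smul] at h2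
      exact hG.mem_right (nsmul_mem (hF.le hz) b) (hF.le hz) h2
    intro F hF G hG h
    exact le_antisymm (key F G hF hG h.subset) (key G F hG hF h.symm.subset)

end Faces

/-! ### Restriction to a face -/

section Restriction

variable {R : Type*} [CommRing R] {Γ : Type*} [AddCommGroup Γ] {K F G : AddSubmonoid Γ}

open scoped Classical in
/-- The endomorphism of `R[K]` which kills all elements outside the face `F`. -/
def faceRestrict (R : Type*) [CommRing R] (hF : IsFace K F) :
    AddMonoidAlgebra R K →+* AddMonoidAlgebra R K :=
  (AddMonoidAlgebra.lift R (AddMonoidAlgebra R K) K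
    { toFun := fun g => if (g.toAdd : Γ) ∈ F then AddMonoidAlgebra.single g.toAdd 1 else 0
      map_one' := if_pos (zero_mem F)
      map_mul' := by
        intro x y
        by_cases hx : (x.toAdd : Γ) ∈ F
        · by_cases hy : (y.toAdd : Γ) ∈ F
          · rw [if_pos hx, if_pos hy, if_pos (by exact add_mem hx hy),
              AddMonoidAlgebra.single_mul_single, mul_one]
            rfl
          · rw [if_neg hy, mul_zero, if_neg]
            exact fun h => hy (hF.mem_right x.toAdd.2 y.toAdd.2 h)
        · rw [if_neg hx, zero_mul, if_neg]
          exact fun h => hx (hF.mem_left _ x.toAdd.2 _ y.toAdd.2 h) }).toRingHom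

open scoped Classical in
lemma faceRestrict_single (hF : IsFace K F) (g : K) (a : R) :
    faceRestrict R hF (AddMonoidAlgebra.single g a) =
      if (g : Γ) ∈ F then AddMonoidAlgebra.single g a else 0 := by
  change AddMonoidAlgebra.lift R (AddMonoidAlgebra R K) K _ _ = _
  rw [AddMonoidAlgebra.lift_single]
  change a • (if (g : Γ) ∈ F then AddMonoidAlgebra.single g 1 else 0 : AddMonoidAlgebra R K) = _
  split_ifs
  · simp
  · simp

open scoped Classical in
lemma coeff_faceRestrict (hF : IsFace K F) (x : AddMonoidAlgebra R K) (g : K) :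
    (faceRestrict R hF x).coeff g = if (g : Γ) ∈ F then x.coeff g else 0 := by
  induction x using AddMonoidAlgebra.induction_linear with
  | zero => simp
  | add x y hx hy =>
    rw [map_add, AddMonoidAlgebra.coeff_add, Finsupp.add_apply, hx, hy]
    split_ifs <;> simp
  | single h a =>
    rw [faceRestrict_single]
    by_cases e : h = g
    · subst e
      split_ifs <;> simp
    · split_ifs <;> simp [AddMonoidAlgebra.coeff_single, e]

open scoped Classical in
lemma faceRestrict_eq_self (hF : IsFace K F) {x : AddMonoidAlgebra R K}
    (hx : ∀ g, x.coeff g ≠ 0 → (g : Γ) ∈ F) : faceRestrict R hF x = x := by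
  ext g
  rw [coeff_faceRestrict, ite_eq_left_iff]
  intro h
  by_contra h'
  exact h (hx g (Ne.symm h'))

lemma faceRestrict_faceRestrict (hF : IsFace K F) (hG : IsFace K G) (hGF : G ≤ F)
    (x : AddMonoidAlgebra R K) : faceRestrict R hG (faceRestrict R hF x) = faceRestrict R hG x := by
  ext g
  simp only [coeff_faceRestrict]
  split_ifs with h1 h2
  · rfl
  · exact absurd (hGF h1) h2
  · rfl

end Restriction

/-! ### Induction on faces -/

section FaceInduction

variable {T : ClassicalType} {n : ℕ}

lemma comp_single {A B : Type*} [CommRing A] [CommRing B] (f : A →+* B) (i : Pos n) :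
    f ∘ (Pi.single i 1 : Pos n → A) = Pi.single i 1 := by
  ext1 j
  rw [Function.comp_apply, Pi.single_apply, Pi.single_apply]
  split_ifs <;> simp

/-- An elementary reduction over a subring can be transported to every row, with control of the
result under homomorphisms. -/
lemma Rel.exists_transport {A B C : Type*} [CommRing A] [CommRing B] [CommRing C] (f : B →+* A)
    {u e : Pos n → B} (h : Rel T u e) (v : Pos n → A) : ∃ v', Rel T v v' ∧
      (∀ ρ : A →+* C, ρ ∘ v = ρ ∘ f ∘ u → ρ ∘ v' = ρ ∘ f ∘ e) ∧
      ∀ ρ ρ' : A →+* C, ρ.comp f = ρ'.comp f → ρ ∘ v = ρ' ∘ v → ρ ∘ v' = ρ' ∘ v' := by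
  obtain ⟨g, hg, rfl⟩ := h
  refine ⟨_, ⟨_, map_mem_E f hg, rfl⟩, fun ρ hρ => ?_, fun ρ ρ' h1 h2 => ?_⟩
  · rw [map_vecMul, map_vecMul, map_vecMul, hρ]
  · have h3 : Matrix.GeneralLinearGroup.map ρ (Matrix.GeneralLinearGroup.map f g) =
        Matrix.GeneralLinearGroup.map ρ' (Matrix.GeneralLinearGroup.map f g) := by
      have := congrArg (fun q => Matrix.GeneralLinearGroup.map q g) h1
      simpa [Matrix.GeneralLinearGroup.map_comp] using this
    rw [map_vecMul, map_vecMul, h2, h3]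

variable {R : Type*} [CommRing R] {r : ℕ} {K F : AddSubmonoid (Fin r → ℤ)}

/-- The inclusion of monoid rings. -/
abbrev inclRing (R : Type*) [CommRing R] {Γ : Type*} [AddCommGroup Γ] {H K : AddSubmonoid Γ}
    (h : H ≤ K) : AddMonoidAlgebra R H →+* AddMonoidAlgebra R K :=
  AddMonoidAlgebra.mapDomainRingHom R (AddSubmonoid.inclusion h)

lemma inclRing_injective {Γ : Type*} [AddCommGroup Γ] {H K : AddSubmonoid Γ} (h : H ≤ K) :
    Function.Injective (inclRing R h) :=
  mapDomainRingHom_injective _ (AddSubmonoid.inclusion_injective h)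

lemma mem_range_inclRing {Γ : Type*} [AddCommGroup Γ] {H K : AddSubmonoid Γ} (h : H ≤ K)
    {x : AddMonoidAlgebra R K} (hx : ∀ g, x.coeff g ≠ 0 → (g : Γ) ∈ H) :
    x ∈ Set.range (inclRing R h) :=
  mem_range_mapDomainRingHom _ (AddSubmonoid.inclusion_injective h) fun g hg =>
    ⟨⟨g, hx g hg⟩, rfl⟩

lemma faceRestrict_inclRing_eq {Γ : Type*} [AddCommGroup Γ] {H K G G' : AddSubmonoid Γ}
    (h : H ≤ K) (hG : IsFace K G) (hG' : IsFace K G') (hGG' : ∀ x ∈ H, x ∈ G ↔ x ∈ G') :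
    (faceRestrict R hG).comp (inclRing R h) = (faceRestrict R hG').comp (inclRing R h) := by
  classical
  refine RingHom.ext fun x => ?_
  induction x using AddMonoidAlgebra.induction_linear with
  | zero => simp
  | add x y hx hy => rw [map_add, map_add, hx, hy]
  | single g a =>
    simp only [RingHom.comp_apply, AddMonoidAlgebra.mapDomainRingHom_apply,
      AddMonoidAlgebra.mapDomain_single, faceRestrict_single]
    exact if_congr (hGG' g g.2) rfl rfl

lemma coeff_mul_mem {M : Type*} [AddCommMonoid M] (P Q S : M → Prop)
    (hPQ : ∀ a b, P a → Q b → S (a + b)) {x y : AddMonoidAlgebra R M}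
    (hx : ∀ g, x.coeff g ≠ 0 → P g) (hy : ∀ g, y.coeff g ≠ 0 → Q g) (g : M)
    (hg : (x * y).coeff g ≠ 0) : S g := by
  classical
  by_contra hS
  rw [AddMonoidAlgebra.coeff_mul] at hg
  refine hg (Finset.sum_eq_zero fun a ha => Finset.sum_eq_zero fun b hb => if_neg ?_)
  rintro rfl
  exact hS (hPQ a b (hx a (Finsupp.mem_support_iff.1 ha)) (hy b (Finsupp.mem_support_iff.1 hb)))

lemma coeff_faceRestrict_ne_zero {Γ : Type*} [AddCommGroup Γ] {K F : AddSubmonoid Γ}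
    (hF : IsFace K F) {x : AddMonoidAlgebra R K} {g : K}
    (hg : (faceRestrict R hF x).coeff g ≠ 0) : (g : Γ) ∈ F ∧ x.coeff g ≠ 0 := by
  classical
  rw [coeff_faceRestrict] at hg
  split_ifs at hg with h
  · exact ⟨h, hg⟩
  · exact absurd rfl hg

lemma dotProduct_comp {A B : Type*} [CommRing A] [CommRing B] (f : A →+* B)
    {v w : Pos n → A} (h : v ⬝ᵥ w = 1) : (f ∘ v) ⬝ᵥ (f ∘ w) = 1 := by
  rw [← RingHom.map_dotProduct, h, map_one]

/-- Reduction along the face of units. -/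
lemma exists_rel_faceRestrict_unitFace
    (hG : ∀ s, TrivialOrbitSpace T n (AddMonoidAlgebra R (Fin s → ℤ)))
    {v : Pos n → AddMonoidAlgebra R K} (hv : v ∈ Um T n (AddMonoidAlgebra R K)) (i : Pos n)
    (hU : IsFace K (unitFace K)) :
    ∃ v', Rel T v v' ∧ faceRestrict R hU ∘ v' = Pi.single i 1 := by
  have hrange : ∀ x, faceRestrict R hU x ∈ Set.range (inclRing R hU.le) := fun x =>
    mem_range_inclRing hU.le fun g hg => (coeff_faceRestrict_ne_zero hU hg).1
  have hid : ∀ y, faceRestrict R hU (inclRing R hU.le y) = inclRing R hU.le y := by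
    intro y
    classical
    induction y using AddMonoidAlgebra.induction_linear with
    | zero => simp
    | add x y hx hy => rw [map_add, map_add, hx, hy]
    | single g a =>
      simp only [AddMonoidAlgebra.mapDomainRingHom_apply, AddMonoidAlgebra.mapDomain_single,
        faceRestrict_single]
      exact if_pos g.2
  obtain ⟨w, hw⟩ := hv.1
  choose u hu using fun j => hrange (v j)
  choose w' hw' using fun j => hrange (w j)
  have hu' : inclRing R hU.le ∘ u = faceRestrict R hU ∘ v := funext hu
  have huw : u ⬝ᵥ w' = 1 := by
    apply inclRing_injective hU.le
    rw [RingHom.map_dotProduct, map_one, hu', show inclRing R hU.le ∘ w' = _ from funext hw']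
    exact dotProduct_comp _ hw
  -- The units form a subgroup of a lattice, which is free of finite rank, so the case of group
  -- rings applies.
  let U : AddSubgroup (Fin r → ℤ) :=
    { unitFace K with
      neg_mem' := by
        rintro x ⟨h1, h2⟩
        exact ⟨h2, by simpa using h1⟩ }
  obtain ⟨s, ⟨b⟩⟩ : ∃ s, Nonempty (U ≃+ (Fin s → ℤ)) := by
    let U' := AddSubgroup.toIntSubmodule U
    exact ⟨_, ⟨(Module.finBasis ℤ U').equivFun.toAddEquiv⟩⟩
  have e : (Fin s → ℤ) ≃+ unitFace K := b.symm
  have htriv := trivialOrbitSpace_of_addEquiv e (hG s)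
  have hum : u ∈ Um T n _ := mem_Um_of_map _ (inclRing_injective hU.le)
    (hu' ▸ map_mem_Um _ hv) ⟨w', huw⟩
  have hrel : Rel T u (Pi.single i 1) := htriv u hum _ (single_mem_Um i)
  obtain ⟨v', h1, h2, -⟩ := hrel.exists_transport (C := AddMonoidAlgebra R K) (inclRing R hU.le) v
  refine ⟨v', h1, ?_⟩
  rw [h2 (faceRestrict R hU), comp_single, comp_single]
  rw [← hu']
  exact funext fun j => (hid (u j)).symm

/-- Induction on a set of faces closed under passing to smaller ones, removing a maximal member `F`.
The reduction is performed over the open monoid of `F`, whose nonzero elements lie in no other face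
of the set. -/
lemma exists_rel_forall_faceRestrict
    (hN : ∀ (N : Type) [AddCommMonoid N], IsAffine N → IsPositive N → IsNormal N →
      TrivialOrbitSpace T n (AddMonoidAlgebra R (interiorMonoid N)))
    (hG : ∀ s, TrivialOrbitSpace T n (AddMonoidAlgebra R (Fin s → ℤ)))
    (hK : ∀ x, 2 • x ∈ K → 3 • x ∈ K → x ∈ K)
    {v : Pos n → AddMonoidAlgebra R K} (hv : v ∈ Um T n (AddMonoidAlgebra R K)) (i : Pos n)
    (𝓛 : Finset (AddSubmonoid (Fin r → ℤ))) (h𝓛 : ∀ F ∈ 𝓛, IsFace K F)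
    (hlow : ∀ F ∈ 𝓛, ∀ G, IsFace K G → G ≤ F → G ∈ 𝓛) :
    ∃ v', Rel T v v' ∧ ∀ F (hF : IsFace K F), F ∈ 𝓛 → faceRestrict R hF ∘ v' = Pi.single i 1 := by
  classical
  induction 𝓛 using Finset.strongInduction with
  | H 𝓛 ih =>
  rcases 𝓛.eq_empty_or_nonempty with rfl | hne
  · exact ⟨v, Rel.refl v, by simp⟩
  obtain ⟨F, hFmax⟩ := 𝓛.exists_maximal hne
  have hF𝓛 := hFmax.prop
  have hF := h𝓛 F hF𝓛
  have hnot : ∀ G ∈ 𝓛, G ≠ F → ¬ F ≤ G := fun G hG hGF hle =>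
    hGF (le_antisymm (hFmax.le_of_ge hG hle) hle)
  by_cases hFU : F = unitFace K
  · subst hFU
    obtain ⟨v', h1, h2⟩ := exists_rel_faceRestrict_unitFace hG hv i hF
    refine ⟨v', h1, fun G hG' hG𝓛 => ?_⟩
    obtain rfl : G = unitFace K := by
      by_contra h
      exact hnot G hG𝓛 h hG'.unitFace_le
    exact h2
  have hU : IsFace K (unitFace K) := isFace_unitFace
  have hU𝓛 : unitFace K ∈ 𝓛 := hlow F hF𝓛 _ hU hF.unitFace_le
  obtain ⟨v₁, h1, h2⟩ := ih (𝓛.erase F) (Finset.erase_ssubset hF𝓛)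
    (fun G hG => h𝓛 G (Finset.mem_of_mem_erase hG)) (fun G hG G' hG' hle =>
      Finset.mem_erase.2 ⟨fun h => hnot G (Finset.mem_of_mem_erase hG) (Finset.ne_of_mem_erase hG)
        (h ▸ hle), hlow G (Finset.mem_of_mem_erase hG) G' hG' hle⟩)
  have hv₁ := h1.mem_Um hv
  have hoK : openInterior F ≤ K := openInterior_le.trans hF.le
  -- A non-interior element of `F` generates a proper face of `F`, on which the row is already the
  -- unit vector. The element `0` is excluded because it lies in the face of units.
  have hsupp : ∀ j (g : K), (g : Fin r → ℤ) ∈ F →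
      (v₁ j - (Pi.single i 1 : Pos n → AddMonoidAlgebra R K) j).coeff g ≠ 0 →
      (g : Fin r → ℤ) ∈ openInterior F ∧ g ≠ 0 := by
    intro j g hg hne
    have hvan : ∀ G (hG : IsFace K G), G ∈ 𝓛 → G ≠ F → (g : Fin r → ℤ) ∉ G := by
      intro G hG hG𝓛 hGF hgG
      have := congrFun (h2 G hG (Finset.mem_erase.2 ⟨hGF, hG𝓛⟩)) j
      refine hne ?_
      have h3 := congrArg (fun x => x.coeff g) this
      simp only [Function.comp_apply, coeff_faceRestrict, if_pos hgG] at h3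
      rw [AddMonoidAlgebra.coeff_sub, Finsupp.sub_apply, h3, sub_self]
    constructor
    · refine (hF.mem_openInterior_or hg).resolve_right fun hGF => ?_
      exact hvan _ (isFace_faceOf (hF.le hg)) (hlow F hF𝓛 _ (isFace_faceOf _) (hF.faceOf_le hg))
        hGF (mem_faceOf _)
    · rintro rfl
      exact hvan _ hU hU𝓛 (Ne.symm hFU) (zero_mem _)
  have hrange : ∀ j, faceRestrict R hF (v₁ j) ∈ Set.range (inclRing R hoK) := by
    intro j
    have h3 : faceRestrict R hF (v₁ j - (Pi.single i 1 : Pos n → AddMonoidAlgebra R K) j) ∈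
        Set.range (inclRing R hoK) := mem_range_inclRing hoK fun g hg =>
      (hsupp j g (coeff_faceRestrict_ne_zero hF hg).1 (coeff_faceRestrict_ne_zero hF hg).2).1
    obtain ⟨a, ha⟩ := h3
    refine ⟨a + (Pi.single i 1 : Pos n → AddMonoidAlgebra R (openInterior F)) j, ?_⟩
    rw [map_add, ha, map_sub, ← Function.comp_apply (f := faceRestrict R hF) (g := Pi.single i 1),
      ← Function.comp_apply (f := inclRing R hoK) (g := Pi.single i 1), comp_single, comp_single,
      sub_add_cancel]
  choose u hu using hrange
  have hu' : inclRing R hoK ∘ u = faceRestrict R hF ∘ v₁ := funext hu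
  obtain ⟨w, hw⟩ := hv₁.1
  -- The first power suffices: `1 - u_i` is supported on nonzero interior elements, and adding an
  -- element of `F` to such an element gives an interior element.
  have huw : ∃ w', u ⬝ᵥ w' = 1 := by
    refine exists_dotProduct_eq_one (inclRing R hoK) (inclRing_injective hoK)
      (w := faceRestrict R hF ∘ w) (by rw [hu']; exact dotProduct_comp _ hw) i 1 fun j => ?_
    refine mem_range_inclRing hoK (coeff_mul_mem (fun g : K => (g : Fin r → ℤ) ∈ F)
      (fun g : K => (g : Fin r → ℤ) ∈ openInterior F ∧ g ≠ 0) _ ?_ ?_ ?_)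
    · rintro a b ha ⟨hb, hb0⟩
      exact add_mem_openInterior hb (fun h => hb0 (Subtype.ext h)) ha
    · exact fun g hg => (coeff_faceRestrict_ne_zero hF hg).1
    · intro g hg
      rw [pow_one, map_sub, map_one, hu, ← map_one (faceRestrict R hF), ← map_sub] at hg
      obtain ⟨h3, h4⟩ := coeff_faceRestrict_ne_zero hF hg
      refine hsupp i g h3 ?_
      rw [Pi.single_eq_same]
      intro h5
      rw [← neg_sub, AddMonoidAlgebra.coeff_neg, Finsupp.neg_apply, h5, neg_zero] at h4
      exact h4 rfl
  have hHtriv := trivialOrbitSpace_of_isOpenSubmonoid hN (hF.isOpenSubmonoid_openInterior hFU hK)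
  have hrel : Rel T u (Pi.single i 1) := hHtriv u (mem_Um_of_map _ (inclRing_injective hoK)
    (hu' ▸ map_mem_Um _ hv₁) huw) _ (single_mem_Um i)
  obtain ⟨v₂, h3, h4, h5⟩ := hrel.exists_transport (C := AddMonoidAlgebra R K) (inclRing R hoK) v₁
  have hFF : ∀ G (hG : IsFace K G), G ≤ F → faceRestrict R hG ∘ v₂ = Pi.single i 1 := by
    intro G hG hGF
    rw [h4 (faceRestrict R hG), comp_single, comp_single]
    rw [hu']
    exact funext fun j => (faceRestrict_faceRestrict hF hG hGF _).symm
  refine ⟨v₂, h1.trans h3, fun G hG hG𝓛 => ?_⟩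
  by_cases hGF : G = F
  · exact hFF G hG hGF.le
  -- On `G`, as on the face of units, only the element `0` of the open monoid survives. Both
  -- restrictions of the matrix and of the old row coincide, hence so do those of the new row, and
  -- the face of units is contained in `F`.
  rw [h5 (faceRestrict R hG) (faceRestrict R hU), hFF _ hU hF.unitFace_le]
  · refine faceRestrict_inclRing_eq hoK hG hU fun x hx => ⟨fun h => ?_, fun h => ?_⟩
    · rw [IsFace.eq_zero_of_mem_openInterior hF.le hG (hnot G hG𝓛 hGF) hx h]
      exact zero_mem _
    · exact hG.unitFace_le h
  · rw [h2 G hG (Finset.mem_erase.2 ⟨hGF, hG𝓛⟩),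
      h2 _ hU (Finset.mem_erase.2 ⟨Ne.symm hFU, hU𝓛⟩)]

theorem trivialOrbitSpace_of_addSubmonoid (hn : 0 < n)
    (hN : ∀ (N : Type) [AddCommMonoid N], IsAffine N → IsPositive N → IsNormal N →
      TrivialOrbitSpace T n (AddMonoidAlgebra R (interiorMonoid N)))
    (hG : ∀ s, TrivialOrbitSpace T n (AddMonoidAlgebra R (Fin s → ℤ)))
    (hK : ∀ x, 2 • x ∈ K → 3 • x ∈ K → x ∈ K) (X : Finset (Fin r → ℤ)) (hX : ∀ x ∈ X, x ∈ K)
    (hKX : ∀ z ∈ K, ∃ c : ℕ, 0 < c ∧ c • z ∈ AddSubmonoid.closure (X : Set (Fin r → ℤ))) :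
    TrivialOrbitSpace T n (AddMonoidAlgebra R K) := by
  refine trivialOrbitSpace_of_forall_rel (⟨0, hn⟩, 0) fun v hv => ?_
  have hfin := finite_setOf_isFace X hX hKX
  obtain ⟨v', h1, h2⟩ := exists_rel_forall_faceRestrict hN hG hK hv (⟨0, hn⟩, 0) hfin.toFinset
    (fun F hF => hfin.mem_toFinset.1 hF) (fun _ _ G hG _ => hfin.mem_toFinset.2 hG)
  have h3 := h2 K (IsFace.refl K) (hfin.mem_toFinset.2 (IsFace.refl K))
  rw [← h3]
  convert h1 using 1
  exact funext fun j => faceRestrict_eq_self _ fun g _ => g.2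

end FaceInduction

/-! ### General seminormal monoids -/

section Seminormal

variable {T : ClassicalType} {n : ℕ} {R : Type*} [CommRing R]

lemma isAddTorsionFree_grothendieckAddGroup {M : Type*} [AddCommMonoid M] [IsCancelAdd M]
    [IsAddTorsionFree M] : IsAddTorsionFree (Algebra.GrothendieckAddGroup M) := by
  refine ⟨fun c hc x y hxy => ?_⟩
  change c • x = c • y at hxy
  obtain ⟨p, hp⟩ := (AddLocalization.addMonoidOf (⊤ : AddSubmonoid M)).surj (x - y)
  have hp : x - y + toGp M p.2 = toGp M p.1 := hp
  have h1 : toGp M (c • (p.2 : M)) = toGp M (c • p.1) := by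
    rw [map_nsmul, map_nsmul, ← hp, smul_add, smul_sub, hxy, sub_self, zero_add]
  have h2 : (p.2 : M) = p.1 :=
    IsAddTorsionFree.nsmul_right_injective hc (Algebra.GrothendieckAddGroup.of_injective h1)
  rw [h2] at hp
  exact sub_eq_zero.1 (add_eq_right.1 hp)

/-- Finitely many elements of `M` generate a lattice in `gp(M)`. Within it, the elements of `M`
having a positive multiple in the monoid generated by the given ones form a submonoid that is still
seminormal. -/
theorem trivialOrbitSpace_of_isSeminormal (hn : 0 < n)
    (hN : ∀ (N : Type) [AddCommMonoid N], IsAffine N → IsPositive N → IsNormal N →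
      TrivialOrbitSpace T n (AddMonoidAlgebra R (interiorMonoid N)))
    (hG : ∀ s, TrivialOrbitSpace T n (AddMonoidAlgebra R (Fin s → ℤ)))
    {M : Type*} [AddCommMonoid M] [IsCancelAdd M] [IsAddTorsionFree M] (hM : IsSeminormal M) :
    TrivialOrbitSpace T n (AddMonoidAlgebra R M) := by
  classical
  have htf : IsAddTorsionFree (Algebra.GrothendieckAddGroup M) :=
    isAddTorsionFree_grothendieckAddGroup
  have hinj : Function.Injective (toGp M) := Algebra.GrothendieckAddGroup.of_injective
  refine trivialOrbitSpace_of_forall_finset fun X => ?_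
  set Y : Set (Algebra.GrothendieckAddGroup M) := toGp M '' X with hY
  obtain ⟨r, ψ, hψ, hψL⟩ : ∃ (r : ℕ) (ψ : (Fin r → ℤ) →+ Algebra.GrothendieckAddGroup M),
      Function.Injective ψ ∧ ψ.range = AddSubgroup.closure Y := by
    let L := AddSubgroup.toIntSubmodule (AddSubgroup.closure Y)
    have : Module.Finite ℤ L := by
      rw [Module.Finite.iff_fg, Submodule.fg_iff_addSubgroup_fg]
      exact ⟨Finset.image (toGp M) X, by rw [Finset.coe_image]; rfl⟩
    have e : L ≃+ (Fin (Module.finrank ℤ L) → ℤ) := (Module.finBasis ℤ L).equivFun.toAddEquiv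
    refine ⟨_, L.subtype.toAddMonoidHom.comp e.symm.toAddMonoidHom,
      L.injective_subtype.comp e.symm.injective, ?_⟩
    ext x
    constructor
    · rintro ⟨z, rfl⟩
      exact (e.symm z).2
    · intro hx
      exact ⟨e ⟨x, hx⟩, congrArg Subtype.val (e.symm_apply_apply ⟨x, hx⟩)⟩
  have hmemY : ∀ x ∈ X, ∃ z, ψ z = toGp M x := fun x hx => by
    rw [← AddMonoidHom.mem_range, hψL]
    exact AddSubgroup.subset_closure ⟨x, hx, rfl⟩
  have hz : ∀ x, ∃ z, x ∈ X → ψ z = toGp M x := fun x => by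
    by_cases hx : x ∈ X
    · obtain ⟨z, hz⟩ := hmemY x hx
      exact ⟨z, fun _ => hz⟩
    · exact ⟨0, fun h => absurd h hx⟩
  choose ζ hζ using hz
  set X' : Finset (Fin r → ℤ) := Finset.image ζ X with hX'
  have himage : ψ '' X' = Y := by
    rw [hX', Finset.coe_image, Set.image_image, hY]
    exact Set.image_congr fun x hx => hζ x hx
  -- `K` need not be finitely generated. Intersecting with the saturation ensures only that its
  -- elements have positive multiples in the monoid generated by `X'`, which is enough for finitely
  -- many faces.
  set K : AddSubmonoid (Fin r → ℤ) :=
    (AddMonoidHom.mrange (toGp M) ⊓ saturation (AddSubgroup.closure Y) Y).comap ψ with hK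
  have hKmem : ∀ z, z ∈ K ↔ ψ z ∈ Set.range (toGp M) ∧
      ∃ c : ℕ, 0 < c ∧ c • ψ z ∈ AddSubmonoid.closure Y := fun z => by
    refine ⟨fun h => ⟨h.1, h.2.2⟩, fun h => ⟨h.1, ?_, h.2⟩⟩
    rw [← hψL]
    exact ⟨z, rfl⟩
  have hζK : ∀ x ∈ X, ζ x ∈ K := fun x hx => by
    rw [hKmem, hζ x hx]
    exact ⟨⟨x, rfl⟩, 1, one_pos, by
      rw [one_smul]; exact AddSubmonoid.subset_closure ⟨x, hx, rfl⟩⟩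
  let ι : M ≃+ AddMonoidHom.mrange (toGp M) := AddEquiv.ofBijective (toGp M).mrangeRestrict
    ⟨fun a b h => hinj (congrArg Subtype.val h), AddMonoidHom.mrangeRestrict_surjective _⟩
  let q : K →+ AddMonoidHom.mrange (toGp M) :=
    (ψ.comp K.subtype).codRestrict _ fun z => z.2.1
  have hq : Function.Injective q := fun a b hab =>
    Subtype.ext (hψ (congrArg Subtype.val hab))
  refine ⟨K, inferInstance, ι.symm.toAddMonoidHom.comp q, ι.symm.injective.comp hq, ?_, ?_⟩
  · intro x hx
    refine ⟨⟨ζ x, hζK x hx⟩, ?_⟩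
    change ι.symm (q _) = x
    rw [AddEquiv.symm_apply_eq]
    exact Subtype.ext (hζ x hx)
  · refine trivialOrbitSpace_of_addSubmonoid hn hN hG ?_ X' ?_ ?_
    · intro x h2 h3
      rw [hKmem, map_nsmul] at h2 h3
      obtain ⟨h2, c, hc, hcx⟩ := h2
      exact (hKmem x).2 ⟨hM _ h2 h3.1, c * 2, by omega, by rwa [mul_smul]⟩
    · intro z hz
      obtain ⟨x, hx, rfl⟩ := Finset.mem_image.1 hz
      exact hζK x hx
    · intro z hz
      obtain ⟨-, c, hc, hcz⟩ := (hKmem z).1 hz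
      refine ⟨c, hc, ?_⟩
      rw [← himage, ← AddMonoidHom.map_mclosure, ← map_nsmul] at hcz
      obtain ⟨y, hy, hyz⟩ := hcz
      rwa [← hψ hyz]

/-- The hypothesis on the stable rank bounds the dimension. -/
lemma exists_stableRange (hn : stableBound T R ≤ ((2 * n : ℕ) : WithBot ℕ∞)) :
    2 ≤ n ∧ ∃ d : ℕ, ringKrullDim R ≤ d ∧ StableRange T n d := by
  cases T
  · rw [stableBound, max_le_iff] at hn
    obtain ⟨h1, h2⟩ := hn
    have h1 : 4 ≤ 2 * n := by exact_mod_cast h1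
    refine ⟨by omega, 2 * n - 2, ?_, by simp only [StableRange]; omega⟩
    generalize ringKrullDim R = D at h2 ⊢
    induction D with
    | bot => exact bot_le
    | coe D =>
      have h3 : D + 2 ≤ ((2 * n : ℕ) : ℕ∞) := WithBot.coe_le_coe.1 h2
      refine WithBot.coe_le_coe.2 (?_ : D ≤ ((2 * n - 2 : ℕ) : ℕ∞))
      induction D with
      | top => exact absurd (top_le_iff.1 h3) (ENat.natCast_ne_top _)
      | coe D =>
        have : D + 2 ≤ 2 * n := by exact_mod_cast h3
        exact_mod_cast (show D ≤ 2 * n - 2 by omega)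
  · rw [stableBound, max_le_iff] at hn
    obtain ⟨h1, h2⟩ := hn
    have h1 : 6 ≤ 2 * n := by exact_mod_cast h1
    refine ⟨by omega, n - 2, ?_, by simp only [StableRange]; omega⟩
    generalize ringKrullDim R = D at h2 ⊢
    induction D with
    | bot => exact bot_le
    | coe D =>
      have h3 : 2 * D + 4 ≤ ((2 * n : ℕ) : ℕ∞) := WithBot.coe_le_coe.1 h2
      refine WithBot.coe_le_coe.2 (?_ : D ≤ ((n - 2 : ℕ) : ℕ∞))
      induction D with
      | top =>
        rw [ENat.mul_top (by simp)] at h3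
        exact absurd (top_le_iff.1 h3) (ENat.natCast_ne_top _)
      | coe D =>
        have : 2 * D + 4 ≤ 2 * n := by exact_mod_cast h3
        exact_mod_cast (show D ≤ n - 2 by omega)

end Seminormal

end MonoidRows

end

theorem proposition4p3 (T : MonoidRows.ClassicalType)
    {R : Type*} [CommRing R] [IsNoetherianRing R]
    (hchar : T = .orthogonal → ringChar R ≠ 2)
    (n : ℕ) (hn : MonoidRows.stableBound T R ≤ ((2 * n : ℕ) : WithBot ℕ∞))
    -- An affine monoid is countable, so the universe `Type` contains a copy of each of them.
    (hN : ∀ (N : Type) [AddCommMonoid N],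
      MonoidRows.IsAffine N → MonoidRows.IsPositive N → MonoidRows.IsNormal N →
        MonoidRows.TrivialOrbitSpace T n (AddMonoidAlgebra R (MonoidRows.interiorMonoid N)))
    {M : Type*} [AddCommMonoid M] [IsCancelAdd M] [IsAddTorsionFree M]
    (hM : MonoidRows.IsSeminormal M) :
    MonoidRows.TrivialOrbitSpace T n (AddMonoidAlgebra R M) := by
  obtain ⟨hn2, d, hd, hnd⟩ := MonoidRows.exists_stableRange hn
  exact MonoidRows.trivialOrbitSpace_of_isSeminormal (by omega) hN
    (MonoidRows.trivialOrbitSpace_int hd hnd hn2 hN) hM
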